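/- **Setting.** Let $f:\mathbb R^n\times\mathbb R^d\to\mathbb R$ be continuously differentiable, let $\Delta\subset\mathbb R^n$ be convex and compact, and let $\delta_0\in\Delta$, $\theta_0\in\mathbb R^d$. Assume that there are constants $\mu>0$, $L_{11}>0$, $L_{12}\ge 0$, $L_{22}>0$ and $\sigma$ such that the following holds for all $\delta,\delta_1,\delta_2\in\Delta$ and $\theta,\theta_1,\theta_2\in\mathbb R^d$. * (Minimax Polyak–Łojasiewicz condition) $\Phi(\delta):=\max_{\theta'}f(\delta,\theta')$ exists and $\tfrac12\|\nabla_\theta f(\delta,\theta)\|^2\ge\mu\,(\Phi(\delta)-f(\delta,\theta))$. * (Lipschitz gradients) $\|\nabla_\delta f(\delta_1,\theta)-\nabla_\delta f(\delta_2,\theta)\|\le L_{11}\|\delta_1-\delta_2\|$, $\|\nabla_\theta f(\delta,\theta_1)-\nabla_\theta f(\delta,\theta_2)\|\le L_{22}\|\theta_1-\theta_2\|$, $\|\nabla_\delta f(\delta,\theta_1)-\nabla_\delta f(\delta,\theta_2)\|\le L_{12}\|\theta_1-\theta_2\|$, $\|\nabla_\theta f(\delta_1,\theta)-\nabla_\theta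 f(\delta_2,\theta)\|\le L_{12}\|\delta_1-\delta_2\|$. A stochastic gradient with batch size $M$ consists of measurable functions $\hat\nabla f(\delta,\theta;\xi)=(\hat\nabla_\delta f,\hat\nabla_\theta f)(\delta,\theta;\xi)$ and of a law $P_{\delta,\theta}$ of the random batch $\xi$ (depending measurably on $(\delta,\theta)$) such that, for $\delta\in\Delta$, $\theta\in\mathbb R^d$ and $\xi\sim P_{\delta,\theta}$, $\mathbb E[\hat\nabla f(\delta,\theta;\xi)]=\nabla f(\delta,\theta)$ and $\mathbb E\|\hat\nabla f(\delta,\theta;\xi)-\nabla f(\delta,\theta)\|^2\le\sigma^2/M$. The Intermittent Attack with step sizes $\eta_1,\eta_2$ and iteration numbers $N,K$ starts at $(\delta_0,\theta_0)$. In round $t=0,\dots,N-1$ it sets $\theta_0(\delta_t)=\theta_t$, performs the inner steps $\theta_{k+1}(\delta_t)=\theta_k(\delta_t)+\eta_1\hat\nabla_\theta f(\delta_t,\theta_k(\delta_t);\xi_{t,k})$ for $k=0,\dots,K-1$, and then sets $\theta_{t+1}=\theta_K(\delta_t)$ and $\delta_{t+1}=\Pi_\Delta\big(\delta_t-\eta_2\hat\nabla_\delta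 f(\delta_t,\theta_K(\delta_t);\xi_{t,K})\big)$, where $\Pi_\Delta$ is the Euclidean projection. Each batch is sampled afresh: given all earlier batches, $\xi_{t,k}$ has the law $P_{\delta_t,\theta_k(\delta_t)}$. A point $(\delta,\theta)\in\Delta\times\mathbb R^d$ is an $\varepsilon$-first-order stationary point ($\varepsilon$-FOSP) of $f$ if $\min_{\delta'\in\Delta,\ \|\delta'-\delta\|\le1}\langle\nabla_\delta f(\delta,\theta),\delta'-\delta\rangle\ge-\varepsilon$ and $\max_{\|\theta'-\theta\|\le1}\langle\nabla_\theta f(\delta,\theta),\theta'-\theta\rangle\le\varepsilon$. Let $\mathrm{gap}(\delta,\theta)$ be the least $\varepsilon$ for which $(\delta,\theta)$ is an $\varepsilon$-FOSP, that is, $\mathrm{gap}(\delta,\theta)=\max\big\{-\min_{\delta'\in\Delta,\ \|\delta'-\delta\|\le1}\langle\nabla_\delta f(\delta,\theta),\delta'-\delta\rangle,\ \max_{\|\theta'-\theta\|\le1}\langle\nabla_\theta f(\delta,\theta),\theta'-\theta\rangle\big\}$. **Theorem.** Put $L=L_{11}+L_{12}^2/(2\mu)$, $\eta_1=1/L_{22}$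 and $\eta_2=1/L$. There is a constant $C>0$, depending only on $f,\Delta,\delta_0,\theta_0,\mu,L_{11},L_{12},L_{22},\sigma$, such that for every $\varepsilon\in(0,1)$, all integers $$N\ge C\varepsilon^{-2},\qquad K\ge C\,(1+\log\varepsilon^{-1}),\qquad M\ge C\varepsilon^{-4},$$ and every stochastic gradient with batch size $M$ as above, there is an index $t\in\{0,\dots,N-1\}$ for which the iterate $(\delta_t,\theta_K(\delta_t))$ of the Intermittent Attack is an $\varepsilon$-FOSP of $f$ in expectation, that is, $\mathrm{gap}(\delta_t,\theta_K(\delta_t))$ is integrable and $$\mathbb E\big[\mathrm{gap}(\delta_t,\theta_K(\delta_t))\big]\le\varepsilon .$$ In particular, with positive probability $(\delta_t,\theta_K(\delta_t))$ is an $\varepsilon$-FOSP of $f$. -/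

import Mathlib

open MeasureTheory ProbabilityTheory

namespace SamplingAttack

/-- `ℝⁿ` with its Euclidean norm. -/
abbrev Vec (n : ℕ) : Type := EuclideanSpace ℝ (Fin n)

variable {n d : ℕ}

/-- The partial gradient of `f` in the first variable (the attack `δ`). -/
noncomputable def gradδ (f : Vec n → Vec d → ℝ) (δ : Vec n) (θ : Vec d) : Vec n :=
  gradient (fun δ' => f δ' θ) δ

/-- The partial gradient of `f` in the second variable (the policy parameter `θ`). -/
noncomputable def gradθ (f : Vec n → Vec d → ℝ) (δ : Vec n) (θ : Vec d) : Vec d :=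
  gradient (fun θ' => f δ θ') θ

/-- The minimax Polyak-Łojasiewicz condition with constant `μ`: for every `δ ∈ Δ` the maximum
`Φ(δ) = max_θ f(δ, θ)` exists, and `½ ‖∇_θ f(δ, θ)‖² ≥ μ (Φ(δ) - f(δ, θ))` for all `θ`. -/
def MinmaxPL (f : Vec n → Vec d → ℝ) (Δ : Set (Vec n)) (μ : ℝ) : Prop :=
  ∀ δ ∈ Δ, ∃ Φδ : ℝ, IsGreatest (Set.range fun θ => f δ θ) Φδ ∧
    ∀ θ, μ * (Φδ - f δ θ) ≤ 1 / 2 * ‖gradθ f δ θ‖ ^ 2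

/-- `f` is continuously differentiable, with partial gradients that are Lipschitz with
constants `L₁₁`, `L₁₂`, `L₂₂`. -/
structure LipschitzGradients (f : Vec n → Vec d → ℝ) (Δ : Set (Vec n)) (L₁₁ L₁₂ L₂₂ : ℝ) :
    Prop where
  contDiff : ContDiff ℝ 1 fun x : Vec n × Vec d => f x.1 x.2
  lip_δδ : ∀ δ₁ ∈ Δ, ∀ δ₂ ∈ Δ, ∀ θ, ‖gradδ f δ₁ θ - gradδ f δ₂ θ‖ ≤ L₁₁ * ‖δ₁ - δ₂‖
  lip_θθ : ∀ δ ∈ Δ, ∀ θ₁ θ₂, ‖gradθ f δ θ₁ - gradθ f δ θ₂‖ ≤ L₂₂ * ‖θ₁ - θ₂‖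
  lip_δθ : ∀ δ ∈ Δ, ∀ θ₁ θ₂, ‖gradδ f δ θ₁ - gradδ f δ θ₂‖ ≤ L₁₂ * ‖θ₁ - θ₂‖
  lip_θδ : ∀ δ₁ ∈ Δ, ∀ δ₂ ∈ Δ, ∀ θ, ‖gradθ f δ₁ θ - gradθ f δ₂ θ‖ ≤ L₁₂ * ‖δ₁ - δ₂‖

/-- The stochastic gradients `(Gδ(δ, θ; ξ), Gθ(δ, θ; ξ))` computed from a batch `ξ` that is
sampled from the law `P (δ, θ)` (the trajectories are rolled out under the current parameters,
so the law may depend on them) are unbiased estimates of `(∇_δ f(δ, θ), ∇_θ f(δ, θ))`, with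
variance at most `v`. -/
structure StochasticGradients {Ξ : Type*} [MeasurableSpace Ξ] (f : Vec n → Vec d → ℝ)
    (Δ : Set (Vec n)) (P : Kernel (Vec n × Vec d) Ξ) (Gδ : Vec n → Vec d → Ξ → Vec n)
    (Gθ : Vec n → Vec d → Ξ → Vec d) (v : ℝ) : Prop where
  measurable_δ : Measurable fun x : (Vec n × Vec d) × Ξ => Gδ x.1.1 x.1.2 x.2
  measurable_θ : Measurable fun x : (Vec n × Vec d) × Ξ => Gθ x.1.1 x.1.2 x.2
  integrable_δ : ∀ δ ∈ Δ, ∀ θ, Integrable (Gδ δ θ) (P (δ, θ))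
  integrable_θ : ∀ δ ∈ Δ, ∀ θ, Integrable (Gθ δ θ) (P (δ, θ))
  unbiased_δ : ∀ δ ∈ Δ, ∀ θ, ∫ ξ, Gδ δ θ ξ ∂(P (δ, θ)) = gradδ f δ θ
  unbiased_θ : ∀ δ ∈ Δ, ∀ θ, ∫ ξ, Gθ δ θ ξ ∂(P (δ, θ)) = gradθ f δ θ
  integrable_sq : ∀ δ ∈ Δ, ∀ θ, Integrable
    (fun ξ => ‖Gδ δ θ ξ - gradδ f δ θ‖ ^ 2 + ‖Gθ δ θ ξ - gradθ f δ θ‖ ^ 2) (P (δ, θ))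
  variance_le : ∀ δ ∈ Δ, ∀ θ,
    ∫ ξ, (‖Gδ δ θ ξ - gradδ f δ θ‖ ^ 2 + ‖Gθ δ θ ξ - gradθ f δ θ‖ ^ 2) ∂(P (δ, θ)) ≤ v

/-- A Euclidean projection of `x` onto `Δ`, i.e. a nearest point of `Δ`. It exists and is unique
if `Δ` is nonempty, closed and convex. -/
noncomputable def proj (Δ : Set (Vec n)) (x : Vec n) : Vec n :=
  Classical.epsilon fun y => y ∈ Δ ∧ ∀ z ∈ Δ, ‖x - y‖ ≤ ‖x - z‖

/-- The inner loop: `θ_{k+1} = θ_k + η₁ Gθ(δ, θ_k; ξ_k)`, started at `θ_0 = θ`. -/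
noncomputable def innerIter {Ξ : Type*} (Gθ : Vec n → Vec d → Ξ → Vec d) (η₁ : ℝ) (δ : Vec n)
    (θ : Vec d) (ξ : ℕ → Ξ) : ℕ → Vec d
  | 0 => θ
  | k + 1 => innerIter Gθ η₁ δ θ ξ k + η₁ • Gθ δ (innerIter Gθ η₁ δ θ ξ k) (ξ k)

/-- The outer loop of the Intermittent Attack: the pair `(δ_t, θ_t)`. Batch `ξ t k` with `k < K`
is used in the `k`-th inner step of round `t`, and batch `ξ t K` in the update of `δ_t`:
`θ_{t+1} = θ_K(δ_t)` and `δ_{t+1} = Π_Δ(δ_t - η₂ Gδ(δ_t, θ_K(δ_t); ξ_{t,K}))`. -/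
noncomputable def outerIter {Ξ : Type*} (Δ : Set (Vec n)) (Gδ : Vec n → Vec d → Ξ → Vec n)
    (Gθ : Vec n → Vec d → Ξ → Vec d) (η₁ η₂ : ℝ) (K : ℕ) (δ₀ : Vec n) (θ₀ : Vec d)
    (ξ : ℕ → ℕ → Ξ) : ℕ → Vec n × Vec d
  | 0 => (δ₀, θ₀)
  | t + 1 =>
    let x := outerIter Δ Gδ Gθ η₁ η₂ K δ₀ θ₀ ξ t
    let θK := innerIter Gθ η₁ x.1 x.2 (ξ t) K
    (proj Δ (x.1 - η₂ • Gδ x.1 θK (ξ t K)), θK)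

/-- The pair `(δ_t, θ_k(δ_t))` of the Intermittent Attack, after `k` inner steps of round `t`. -/
noncomputable def attackIter {Ξ : Type*} (Δ : Set (Vec n)) (Gδ : Vec n → Vec d → Ξ → Vec n)
    (Gθ : Vec n → Vec d → Ξ → Vec d) (η₁ η₂ : ℝ) (K : ℕ) (δ₀ : Vec n) (θ₀ : Vec d)
    (ξ : ℕ → ℕ → Ξ) (t k : ℕ) : Vec n × Vec d :=
  let x := outerIter Δ Gδ Gθ η₁ η₂ K δ₀ θ₀ ξ t
  (x.1, innerIter Gθ η₁ x.1 x.2 (ξ t) k)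

/-- The batches drawn before the batch `ξ t k`: all those of the earlier rounds, and those of
the earlier steps of round `t`. -/
abbrev Earlier (K t k : ℕ) : Type := {p : ℕ × ℕ // (p.1 < t ∧ p.2 ≤ K) ∨ (p.1 = t ∧ p.2 < k)}

/-- The batches `ξ t k`, `t < N`, `k ≤ K`, are freshly sampled at the current iterates of the
Intermittent Attack: given all earlier batches, the conditional law of `ξ t k` is
`P (δ_t, θ_k(δ_t))`. -/
def IsAttackSampling {Ω Ξ : Type*} [MeasurableSpace Ω] [MeasurableSpace Ξ] (Pr : Measure Ω)
    (Δ : Set (Vec n)) (P : Kernel (Vec n × Vec d) Ξ) (Gδ : Vec n → Vec d → Ξ → Vec n)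
    (Gθ : Vec n → Vec d → Ξ → Vec d) (η₁ η₂ : ℝ) (N K : ℕ) (δ₀ : Vec n) (θ₀ : Vec d)
    (ξ : ℕ → ℕ → Ω → Ξ) : Prop :=
  ∀ t < N, ∀ k ≤ K, HasCondDistrib (ξ t k)
    (fun ω => ((fun p : Earlier K t k => ξ p.1.1 p.1.2 ω),
      attackIter Δ Gδ Gθ η₁ η₂ K δ₀ θ₀ (fun s j => ξ s j ω) t k))
    (Kernel.prodMkLeft (Earlier K t k → Ξ) P) Pr

/-- `(δ, θ)` is an `ε`-first-order stationary point of `f` on `Δ × ℝᵈ`. -/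
def IsFOSP (f : Vec n → Vec d → ℝ) (Δ : Set (Vec n)) (ε : ℝ) (δ : Vec n) (θ : Vec d) : Prop :=
  δ ∈ Δ ∧ (∀ δ' ∈ Δ, ‖δ' - δ‖ ≤ 1 → -ε ≤ inner ℝ (gradδ f δ θ) (δ' - δ)) ∧
    ∀ θ' : Vec d, ‖θ' - θ‖ ≤ 1 → inner ℝ (gradθ f δ θ) (θ' - θ) ≤ ε

/-- The stationarity gap at `(δ, θ)`: the larger one of
`- min {⟨∇_δ f(δ, θ), δ' - δ⟩ : δ' ∈ Δ, ‖δ' - δ‖ ≤ 1}` and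
`max {⟨∇_θ f(δ, θ), θ' - θ⟩ : ‖θ' - θ‖ ≤ 1}`. -/
noncomputable def fospGap (f : Vec n → Vec d → ℝ) (Δ : Set (Vec n)) (δ : Vec n) (θ : Vec d) : ℝ :=
  max (sSup ((fun δ' => -inner ℝ (gradδ f δ θ) (δ' - δ)) '' {δ' | δ' ∈ Δ ∧ ‖δ' - δ‖ ≤ 1}))
    (sSup ((fun θ' => inner ℝ (gradθ f δ θ) (θ' - θ)) '' {θ' | ‖θ' - θ‖ ≤ 1}))

/-- The stationarity gap is the least `ε` for which the point is an `ε`-first-order stationary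
point. -/
theorem isFOSP_iff_fospGap_le (f : Vec n → Vec d → ℝ) (Δ : Set (Vec n)) (ε : ℝ) {δ : Vec n}
    (hδ : δ ∈ Δ) (θ : Vec d) : IsFOSP f Δ ε δ θ ↔ fospGap f Δ δ θ ≤ ε := by
  have b : ∀ {m : ℕ} (g x y : Vec m), ‖y - x‖ ≤ 1 → |inner ℝ g (y - x)| ≤ ‖g‖ := fun g x y h =>
    (abs_real_inner_le_norm _ _).trans (mul_le_of_le_one_right (norm_nonneg _) h)
  unfold IsFOSP fospGap
  rw [max_le_iff, csSup_le_iff, csSup_le_iff]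
  · simp only [Set.forall_mem_image, Set.mem_ofPred_eq, and_imp, hδ, true_and]
    refine and_congr_left fun _ => forall₃_congr fun _ _ _ => ?_
    exact neg_le
  · exact ⟨‖gradθ f δ θ‖, by
      rintro _ ⟨y, hy, rfl⟩
      exact (le_abs_self _).trans (b _ _ _ hy)⟩
  · exact ⟨_, θ, by simp, rfl⟩
  · exact ⟨‖gradδ f δ θ‖, by
      rintro _ ⟨y, hy, rfl⟩
      exact (neg_le_abs _).trans (b _ _ _ hy.2)⟩
  · exact ⟨_, δ, ⟨hδ, by simp⟩, rfl⟩

end SamplingAttack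

open SamplingAttack

namespace SamplingAttack

variable {n d : ℕ}

/-- The two-sided quadratic bound for a function whose gradient is Lipschitz on a convex set. -/
theorem abs_sub_sub_inner_gradient_le {m : ℕ} {g : Vec m → ℝ} (hg : Differentiable ℝ g)
    {s : Set (Vec m)} (hs : Convex ℝ s) {L : ℝ}
    (hL : ∀ x ∈ s, ∀ y ∈ s, ‖gradient g x - gradient g y‖ ≤ L * ‖x - y‖)
    {x y : Vec m} (hx : x ∈ s) (hy : y ∈ s) :
    |g y - g x - inner ℝ (gradient g x) (y - x)| ≤ L / 2 * ‖y - x‖ ^ 2 := by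
  set F : ℝ → ℝ := fun r => g (x + r • (y - x)) - g x - r * inner ℝ (gradient g x) (y - x)
  have hF : ∀ r, HasDerivAt F
      (inner ℝ (gradient g (x + r • (y - x))) (y - x) - inner ℝ (gradient g x) (y - x)) r := by
    intro r
    have h1 : HasDerivAt (fun r : ℝ => x + r • (y - x)) (y - x) r := by
      simpa using ((hasDerivAt_id r).smul_const (y - x)).const_add x
    have h2 := (hg (x + r • (y - x))).hasGradientAt.hasFDerivAt.comp_hasDerivAt r h1
    have h3 := (h2.sub_const (g x)).sub
      ((hasDerivAt_id r).mul_const (inner ℝ (gradient g x) (y - x)))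
    exact (show HasDerivAt F _ r from h3).congr_deriv (by simp)
  have key := image_norm_le_of_norm_deriv_right_le_deriv_boundary (f := F) (a := 0) (b := 1)
    (B := fun r => L / 2 * ‖y - x‖ ^ 2 * r ^ 2) (B' := fun r => L * ‖y - x‖ ^ 2 * r)
    (fun r _ => (hF r).continuousAt.continuousWithinAt) (fun r _ => (hF r).hasDerivWithinAt)
    (by simp [F])
    (fun r => by
      have := (hasDerivAt_pow 2 r).const_mul (L / 2 * ‖y - x‖ ^ 2)
      exact this.congr_deriv (by push_cast; ring))
    (fun r hr => by
      rw [← inner_sub_left]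
      refine (norm_inner_le_norm _ _).trans ?_
      have hm : x + r • (y - x) ∈ s := hs.add_smul_sub_mem hx hy ⟨hr.1, hr.2.le⟩
      have h4 := hL _ hm _ hx
      rw [add_sub_cancel_left, norm_smul, Real.norm_of_nonneg hr.1] at h4
      nlinarith [mul_le_mul_of_nonneg_right h4 (norm_nonneg (y - x))])
    (Set.right_mem_Icc.2 zero_le_one)
  simpa [F] using key

/-- The maximum `Φ(δ)` of `f(δ, ·)`. -/
noncomputable def maxVal (f : Vec n → Vec d → ℝ) (δ : Vec n) : ℝ := ⨆ θ, f δ θ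

/-- The suboptimality `Φ(δ) - f(δ, θ)` of `θ` in the inner maximization. -/
noncomputable def subopt (f : Vec n → Vec d → ℝ) (δ : Vec n) (θ : Vec d) : ℝ :=
  maxVal f δ - f δ θ

section Deterministic

variable {f : Vec n → Vec d → ℝ} {Δ : Set (Vec n)} {μ L₁₁ L₁₂ L₂₂ : ℝ}

theorem MinmaxPL.bddAbove (hPL : MinmaxPL f Δ μ) {δ : Vec n} (hδ : δ ∈ Δ) :
    BddAbove (Set.range fun θ => f δ θ) := by
  obtain ⟨Φ, h, -⟩ := hPL δ hδ
  exact ⟨Φ, h.2⟩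

theorem MinmaxPL.mul_subopt_le (hPL : MinmaxPL f Δ μ) {δ : Vec n} (hδ : δ ∈ Δ) (θ : Vec d) :
    μ * subopt f δ θ ≤ 1 / 2 * ‖gradθ f δ θ‖ ^ 2 := by
  obtain ⟨Φ, h, h'⟩ := hPL δ hδ
  have : maxVal f δ = Φ := h.csSup_eq
  rw [subopt, this]
  exact h' θ

theorem MinmaxPL.subopt_nonneg (hPL : MinmaxPL f Δ μ) {δ : Vec n} (hδ : δ ∈ Δ) (θ : Vec d) :
    0 ≤ subopt f δ θ :=
  sub_nonneg.2 (le_ciSup (hPL.bddAbove hδ) θ)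

theorem LipschitzGradients.differentiable_left (hLip : LipschitzGradients f Δ L₁₁ L₁₂ L₂₂)
    (θ : Vec d) : Differentiable ℝ fun δ => f δ θ :=
  (hLip.contDiff.differentiable one_ne_zero).comp
    (differentiable_id.prodMk (differentiable_const θ))

theorem LipschitzGradients.differentiable_right (hLip : LipschitzGradients f Δ L₁₁ L₁₂ L₂₂)
    (δ : Vec n) : Differentiable ℝ fun θ => f δ θ :=
  (hLip.contDiff.differentiable one_ne_zero).comp
    ((differentiable_const δ).prodMk differentiable_id)

theorem LipschitzGradients.abs_sub_sub_inner_gradδ_le (hLip : LipschitzGradients f Δ L₁₁ L₁₂ L₂₂)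
    (hconv : Convex ℝ Δ) {δ δ' : Vec n} (hδ : δ ∈ Δ) (hδ' : δ' ∈ Δ) (θ : Vec d) :
    |f δ' θ - f δ θ - inner ℝ (gradδ f δ θ) (δ' - δ)| ≤ L₁₁ / 2 * ‖δ' - δ‖ ^ 2 :=
  abs_sub_sub_inner_gradient_le (hLip.differentiable_left θ) hconv
    (fun x hx y hy => hLip.lip_δδ x hx y hy θ) hδ hδ'

/-- One ascent step of length `1 / L₂₂` along an inexact gradient `G`. -/
theorem LipschitzGradients.subopt_add_smul_le (hLip : LipschitzGradients f Δ L₁₁ L₁₂ L₂₂)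
    (hL₂₂ : 0 < L₂₂) {δ : Vec n} (hδ : δ ∈ Δ) (θ G : Vec d) :
    subopt f δ (θ + (1 / L₂₂) • G) ≤ subopt f δ θ - ‖gradθ f δ θ‖ ^ 2 / (2 * L₂₂)
      + ‖G - gradθ f δ θ‖ ^ 2 / (2 * L₂₂) := by
  have h := abs_sub_sub_inner_gradient_le (hLip.differentiable_right δ) convex_univ
    (fun x _ y _ => hLip.lip_θθ δ hδ x y) (Set.mem_univ θ) (Set.mem_univ (θ + (1 / L₂₂) • G))
  rw [add_sub_cancel_left, inner_smul_right, norm_smul, mul_pow, Real.norm_eq_abs, sq_abs] at h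
  have h1 := (abs_le.1 h).1
  have h2 : ‖G - gradθ f δ θ‖ ^ 2
      = ‖G‖ ^ 2 - 2 * inner ℝ (gradθ f δ θ) G + ‖gradθ f δ θ‖ ^ 2 := by
    rw [norm_sub_sq_real, real_inner_comm]
  have h3 : L₂₂ / 2 * ((1 / L₂₂) ^ 2 * ‖G‖ ^ 2) = ‖G‖ ^ 2 / (2 * L₂₂) := by
    field_simp
  have h4 : (‖G‖ ^ 2 - 2 * inner ℝ (gradθ f δ θ) G + ‖gradθ f δ θ‖ ^ 2) / (2 * L₂₂)
      = ‖G‖ ^ 2 / (2 * L₂₂) - 1 / L₂₂ * inner ℝ (gradθ f δ θ) G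
        + ‖gradθ f δ θ‖ ^ 2 / (2 * L₂₂) := by
    field_simp
  rw [h2, h4]
  rw [h3] at h1
  simp only [subopt, gradθ] at h1 ⊢
  linarith

theorem sq_norm_gradθ_le (hPL : MinmaxPL f Δ μ) (hLip : LipschitzGradients f Δ L₁₁ L₁₂ L₂₂)
    (hL₂₂ : 0 < L₂₂) {δ : Vec n} (hδ : δ ∈ Δ) (θ : Vec d) :
    ‖gradθ f δ θ‖ ^ 2 ≤ 2 * L₂₂ * subopt f δ θ := by
  have h := hLip.subopt_add_smul_le hL₂₂ hδ θ (gradθ f δ θ)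
  have h1 := hPL.subopt_nonneg hδ (θ + (1 / L₂₂) • gradθ f δ θ)
  rw [sub_self, norm_zero] at h
  have h2 : ‖gradθ f δ θ‖ ^ 2 / (2 * L₂₂) ≤ subopt f δ θ := by simp at h h1 ⊢; linarith
  rwa [div_le_iff₀ (by positivity), mul_comm] at h2

/-- Up to the error of the gradient, an ascent step contracts the suboptimality. -/
theorem subopt_add_smul_le_mul (hPL : MinmaxPL f Δ μ)
    (hLip : LipschitzGradients f Δ L₁₁ L₁₂ L₂₂) (hL₂₂ : 0 < L₂₂) {δ : Vec n} (hδ : δ ∈ Δ)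
    (θ G : Vec d) :
    subopt f δ (θ + (1 / L₂₂) • G) ≤ (1 - min μ L₂₂ / L₂₂) * subopt f δ θ
      + ‖G - gradθ f δ θ‖ ^ 2 / (2 * L₂₂) := by
  have h := hLip.subopt_add_smul_le hL₂₂ hδ θ G
  have h1 : min μ L₂₂ / L₂₂ * subopt f δ θ ≤ ‖gradθ f δ θ‖ ^ 2 / (2 * L₂₂) := by
    rw [div_mul_eq_mul_div, div_le_div_iff₀ hL₂₂ (by positivity)]
    have := hPL.mul_subopt_le hδ θ
    have h2 := mul_le_mul_of_nonneg_right (min_le_left μ L₂₂) (hPL.subopt_nonneg hδ θ)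
    nlinarith
  linarith

/-- The suboptimality of a fixed `θ` changes in a controlled way with `δ`. -/
theorem subopt_le_of_mem (hPL : MinmaxPL f Δ μ) (hLip : LipschitzGradients f Δ L₁₁ L₁₂ L₂₂)
    (hμ : 0 < μ) (hL₂₂ : 0 < L₂₂) {τ : ℝ} (hτ : 0 < τ) {δ δ' : Vec n}
    (hδ : δ ∈ Δ) (hδ' : δ' ∈ Δ) (θ : Vec d) :
    subopt f δ' θ ≤ (1 + τ⁻¹) * (L₂₂ / μ) * subopt f δ θ
      + (1 + τ) * (L₁₂ ^ 2 / (2 * μ)) * ‖δ' - δ‖ ^ 2 := by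
  have h1 := hPL.mul_subopt_le hδ' θ
  have h2 := sq_norm_gradθ_le hPL hLip hL₂₂ hδ θ
  have h3 : ‖gradθ f δ' θ‖ ≤ ‖gradθ f δ θ‖ + L₁₂ * ‖δ' - δ‖ := by
    have := norm_le_norm_add_norm_sub' (gradθ f δ' θ) (gradθ f δ θ)
    have := hLip.lip_θδ δ' hδ' δ hδ θ
    linarith
  set a := ‖gradθ f δ θ‖
  set b := L₁₂ * ‖δ' - δ‖
  have h4 : ‖gradθ f δ' θ‖ ^ 2 ≤ (a + b) ^ 2 := pow_le_pow_left₀ (norm_nonneg _) h3 2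
  have h5 : (a + b) ^ 2 ≤ (1 + τ⁻¹) * a ^ 2 + (1 + τ) * b ^ 2 := by
    have h6 : (1 + τ⁻¹) * a ^ 2 + (1 + τ) * b ^ 2 - (a + b) ^ 2 = τ⁻¹ * (a - τ * b) ^ 2 := by
      field_simp
      ring
    have : 0 ≤ τ⁻¹ * (a - τ * b) ^ 2 := by positivity
    linarith
  have h7 : (1 + τ⁻¹) * a ^ 2 ≤ (1 + τ⁻¹) * (2 * L₂₂ * subopt f δ θ) :=
    mul_le_mul_of_nonneg_left h2 (by positivity)
  have h8 : subopt f δ' θ ≤ ((1 + τ⁻¹) * (2 * L₂₂ * subopt f δ θ) + (1 + τ) * b ^ 2) / (2 * μ) := by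
    rw [le_div_iff₀ (by positivity)]
    linarith
  refine h8.trans_eq ?_
  simp only [b]
  field_simp

end Deterministic

section Projection

variable {Δ : Set (Vec n)}

theorem proj_spec (hcomp : IsCompact Δ) (hne : Δ.Nonempty) (x : Vec n) :
    proj Δ x ∈ Δ ∧ ∀ z ∈ Δ, ‖x - proj Δ x‖ ≤ ‖x - z‖ := by
  obtain ⟨y, hy, h⟩ := hcomp.exists_isMinOn hne
    (f := fun z => ‖x - z‖) (by fun_prop)
  exact Classical.epsilon_spec (p := fun y => y ∈ Δ ∧ ∀ z ∈ Δ, ‖x - y‖ ≤ ‖x - z‖) ⟨y, hy, h⟩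

theorem proj_mem (hcomp : IsCompact Δ) (hne : Δ.Nonempty) (x : Vec n) : proj Δ x ∈ Δ :=
  (proj_spec hcomp hne x).1

theorem inner_sub_proj_le (hconv : Convex ℝ Δ) (hcomp : IsCompact Δ) (hne : Δ.Nonempty)
    (x : Vec n) {z : Vec n} (hz : z ∈ Δ) : inner ℝ (x - proj Δ x) (z - proj Δ x) ≤ 0 := by
  have h := proj_spec hcomp hne x
  have : Nonempty Δ := hne.to_subtype
  refine (norm_eq_iInf_iff_real_inner_le_zero hconv h.1).1 ?_ z hz
  exact le_antisymm (le_ciInf fun w => h.2 w w.2)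
    (ciInf_le (f := fun w : Δ => ‖x - w‖) ⟨0, by rintro _ ⟨w, rfl⟩; exact norm_nonneg _⟩ ⟨_, h.1⟩)

theorem proj_of_mem (hcomp : IsCompact Δ) {x : Vec n} (hx : x ∈ Δ) : proj Δ x = x := by
  have h := (proj_spec hcomp ⟨x, hx⟩ x).2 x hx
  rw [sub_self, norm_zero, norm_le_zero_iff, sub_eq_zero] at h
  exact h.symm

theorem continuous_proj (hconv : Convex ℝ Δ) (hcomp : IsCompact Δ) (hne : Δ.Nonempty) :
    Continuous (proj Δ) := by
  refine (LipschitzWith.of_dist_le' (K := 1) fun x y => ?_).continuous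
  rw [dist_eq_norm, dist_eq_norm, one_mul]
  have h1 := inner_sub_proj_le hconv hcomp hne x (proj_mem hcomp hne y)
  have h2 := inner_sub_proj_le hconv hcomp hne y (proj_mem hcomp hne x)
  have h3 : ‖proj Δ x - proj Δ y‖ ^ 2 ≤ inner ℝ (x - y) (proj Δ x - proj Δ y) := by
    have e : inner ℝ (x - y) (proj Δ x - proj Δ y) = ‖proj Δ x - proj Δ y‖ ^ 2
        - inner ℝ (x - proj Δ x) (proj Δ y - proj Δ x)
        - inner ℝ (y - proj Δ y) (proj Δ x - proj Δ y) := by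
      rw [← real_inner_self_eq_norm_sq]
      simp only [inner_sub_left, inner_sub_right]
      ring
    linarith
  have h4 := h3.trans (real_inner_le_norm _ _)
  rcases (norm_nonneg (proj Δ x - proj Δ y)).eq_or_lt with h | h
  · rw [← h]; exact norm_nonneg _
  · rw [sq] at h4
    exact le_of_mul_le_mul_right h4 h

/-- The variational inequality for the projected gradient step of length `1 / L`. -/
theorem inner_sub_proj_step_le (hconv : Convex ℝ Δ) (hcomp : IsCompact Δ) {L : ℝ} (hL : 0 < L)
    {δ : Vec n} (hδ : δ ∈ Δ) (G : Vec n) {z : Vec n} (hz : z ∈ Δ) :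
    inner ℝ G (proj Δ (δ - (1 / L) • G) - z)
      ≤ L * inner ℝ (proj Δ (δ - (1 / L) • G) - δ) (z - proj Δ (δ - (1 / L) • G)) := by
  have h := inner_sub_proj_le hconv hcomp ⟨δ, hδ⟩ (δ - (1 / L) • G) hz
  set p := proj Δ (δ - (1 / L) • G)
  have e : inner ℝ (δ - (1 / L) • G - p) (z - p)
      = 1 / L * inner ℝ G (p - z) - inner ℝ (p - δ) (z - p) := by
    rw [← sub_eq_zero]
    simp only [inner_sub_left, inner_sub_right, real_inner_smul_left]
    ring
  rw [e, sub_nonpos, one_div, inv_mul_le_iff₀ hL] at h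
  exact h

end Projection

section Step

variable {f : Vec n → Vec d → ℝ} {Δ : Set (Vec n)} {μ L₁₁ L₁₂ L₂₂ L : ℝ}

/-- The projected step along an inexact gradient `G` decreases `Φ`, up to the suboptimality of `θ`
and the error of the gradient. -/
theorem exists_sq_norm_proj_step_le (hconv : Convex ℝ Δ) (hcomp : IsCompact Δ)
    (hPL : MinmaxPL f Δ μ) (hLip : LipschitzGradients f Δ L₁₁ L₁₂ L₂₂)
    (hμ : 0 < μ) (hL₁₁ : 0 < L₁₁) (hL₂₂ : 0 < L₂₂) (hL : L = L₁₁ + L₁₂ ^ 2 / (2 * μ)) :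
    ∃ c : ℝ, 0 < c ∧ ∀ δ ∈ Δ, ∀ (θ : Vec d) (G : Vec n),
      L₁₁ / 4 * ‖proj Δ (δ - (1 / L) • G) - δ‖ ^ 2
        ≤ maxVal f δ - maxVal f (proj Δ (δ - (1 / L) • G))
          + c * (subopt f δ θ + ‖G - gradδ f δ θ‖ ^ 2) := by
  set B := L₁₂ ^ 2 / (2 * μ)
  have hB : 0 ≤ B := by positivity
  set τ := L₁₁ / (8 * (B + 1))
  have hτ : 0 < τ := by positivity
  have hτB : τ * B ≤ L₁₁ / 8 := by
    have : τ * (B + 1) = L₁₁ / 8 := by simp only [τ]; field_simp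
    linarith
  have hL0 : 0 < L := by rw [hL]; positivity
  set c₁ := (1 + τ⁻¹) * (L₂₂ / μ)
  have hc₁ : 0 < c₁ := by positivity
  refine ⟨c₁ + 2 / L₁₁, by positivity, fun δ hδ θ G => ?_⟩
  set p := proj Δ (δ - (1 / L) • G) with hp
  have hpm : p ∈ Δ := proj_mem hcomp ⟨δ, hδ⟩ _
  have h1 := subopt_le_of_mem hPL hLip hμ hL₂₂ hτ hδ hpm θ
  have h2 := (abs_le.1 (hLip.abs_sub_sub_inner_gradδ_le hconv hδ hpm θ)).2
  have h3 := inner_sub_proj_step_le hconv hcomp hL0 hδ G hδ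
  rw [← hp, ← neg_sub p δ, inner_neg_right, real_inner_self_eq_norm_sq] at h3
  have h4 : inner ℝ (gradδ f δ θ) (p - δ)
      = inner ℝ G (p - δ) - inner ℝ (G - gradδ f δ θ) (p - δ) := by
    rw [inner_sub_left]; ring
  have h5 := (abs_le.1 (abs_real_inner_le_norm (G - gradδ f δ θ) (p - δ))).1
  set e := ‖G - gradδ f δ θ‖
  set r := ‖p - δ‖
  have h6 : e * r ≤ L₁₁ / 8 * r ^ 2 + 2 / L₁₁ * e ^ 2 := by
    have : L₁₁ / 8 * r ^ 2 + 2 / L₁₁ * e ^ 2 - e * r = 2 / L₁₁ * (e - L₁₁ / 4 * r) ^ 2 := by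
      field_simp
      ring
    have : 0 ≤ 2 / L₁₁ * (e - L₁₁ / 4 * r) ^ 2 := by positivity
    linarith
  have h7 : τ * B * r ^ 2 ≤ L₁₁ / 8 * r ^ 2 := by gcongr
  have h8 := hPL.subopt_nonneg hδ θ
  have h9 : 0 ≤ 2 / L₁₁ * subopt f δ θ + c₁ * e ^ 2 := by positivity
  have h10 : L * r ^ 2 = L₁₁ * r ^ 2 + B * r ^ 2 := by rw [hL]; ring
  have h11 : maxVal f p = f p θ + subopt f p θ := by simp [subopt]
  have h12 : maxVal f δ = f δ θ + subopt f δ θ := by simp [subopt]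
  linarith

theorem fospGap_le_of_proj_step (hconv : Convex ℝ Δ) (hcomp : IsCompact Δ)
    (hPL : MinmaxPL f Δ μ) (hLip : LipschitzGradients f Δ L₁₁ L₁₂ L₂₂)
    (hL₂₂ : 0 < L₂₂) (hL : 0 < L) {D : ℝ} (hD : ∀ x ∈ Δ, ∀ y ∈ Δ, ‖x - y‖ ≤ D)
    {δ : Vec n} (hδ : δ ∈ Δ) (θ : Vec d) (G : Vec n) :
    fospGap f Δ δ θ ≤ f δ θ - f (proj Δ (δ - (1 / L) • G)) θ
      + L₁₁ / 2 * ‖proj Δ (δ - (1 / L) • G) - δ‖ ^ 2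
      + D * (L * ‖proj Δ (δ - (1 / L) • G) - δ‖ + ‖G - gradδ f δ θ‖)
      + √(2 * L₂₂ * subopt f δ θ) := by
  set p := proj Δ (δ - (1 / L) • G) with hp
  have hpm : p ∈ Δ := proj_mem hcomp ⟨δ, hδ⟩ _
  set X := f δ θ - f p θ + L₁₁ / 2 * ‖p - δ‖ ^ 2 + D * (L * ‖p - δ‖ + ‖G - gradδ f δ θ‖)
  have hX : ∀ z ∈ Δ, -inner ℝ (gradδ f δ θ) (z - δ) ≤ X := by
    intro z hz
    have h1 := (abs_le.1 (hLip.abs_sub_sub_inner_gradδ_le hconv hδ hpm θ)).2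
    have h2 := inner_sub_proj_step_le hconv hcomp hL hδ G hz
    rw [← hp] at h2
    have h3 := real_inner_le_norm (p - δ) (z - p)
    have h4 := (abs_le.1 (abs_real_inner_le_norm (G - gradδ f δ θ) (p - z))).1
    have e : -inner ℝ (gradδ f δ θ) (z - δ) = -inner ℝ (gradδ f δ θ) (p - δ)
        + inner ℝ G (p - z) - inner ℝ (G - gradδ f δ θ) (p - z) := by
      simp only [inner_sub_left, inner_sub_right]
      ring
    have h5 : ‖p - δ‖ * ‖z - p‖ ≤ ‖p - δ‖ * D := by gcongr; exact hD z hz p hpm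
    have h6 : ‖G - gradδ f δ θ‖ * ‖p - z‖ ≤ ‖G - gradδ f δ θ‖ * D := by
      gcongr; exact hD p hpm z hz
    have h7 := mul_le_mul_of_nonneg_left (h3.trans h5) hL.le
    simp only [X]
    linarith
  have hX0 : 0 ≤ X := by simpa using hX δ hδ
  refine (isFOSP_iff_fospGap_le f Δ _ hδ θ).1 ⟨hδ, fun z hz _ => ?_, fun z hz => ?_⟩
  · have := hX z hz
    have := Real.sqrt_nonneg (2 * L₂₂ * subopt f δ θ)
    linarith
  · have h1 : ‖gradθ f δ θ‖ ≤ √(2 * L₂₂ * subopt f δ θ) :=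
      Real.le_sqrt_of_sq_le (sq_norm_gradθ_le hPL hLip hL₂₂ hδ θ)
    have h2 := (real_inner_le_norm (gradθ f δ θ) (z - θ)).trans
      (mul_le_of_le_one_right (norm_nonneg _) hz)
    linarith

theorem mul_le_add_sq_div {ε : ℝ} (hε : 0 < ε) (a : ℝ) : a ≤ ε / 8 + 2 * a ^ 2 / ε := by
  have : ε / 8 + 2 * a ^ 2 / ε - a = 2 / ε * (a - ε / 4) ^ 2 := by
    field_simp
    ring
  have : 0 ≤ 2 / ε * (a - ε / 4) ^ 2 := by positivity
  linarith

/-- The stationarity gap is controlled by the decrease of `Φ` in the projected step, the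
suboptimality of `θ` and the error of the gradient. -/
theorem exists_fospGap_le (hconv : Convex ℝ Δ) (hcomp : IsCompact Δ)
    (hPL : MinmaxPL f Δ μ) (hLip : LipschitzGradients f Δ L₁₁ L₁₂ L₂₂)
    (hμ : 0 < μ) (hL₁₁ : 0 < L₁₁) (hL₂₂ : 0 < L₂₂) (hL : L = L₁₁ + L₁₂ ^ 2 / (2 * μ)) :
    ∃ c : ℝ, 0 < c ∧ ∀ ε : ℝ, 0 < ε → ε < 1 → ∃ a : ℝ, 0 ≤ a ∧ a ≤ c / ε ∧
      ∀ δ ∈ Δ, ∀ (θ : Vec d) (G : Vec n),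
        fospGap f Δ δ θ ≤ ε / 2 + a * (maxVal f δ - maxVal f (proj Δ (δ - (1 / L) • G)))
          + c / ε * (subopt f δ θ + ‖G - gradδ f δ θ‖ ^ 2) := by
  obtain ⟨b, hb, hdesc⟩ := exists_sq_norm_proj_step_le hconv hcomp hPL hLip hμ hL₁₁ hL₂₂ hL
  obtain ⟨D, hD⟩ : ∃ D, ∀ x ∈ Δ, ∀ y ∈ Δ, ‖x - y‖ ≤ D := by
    obtain ⟨D, hD⟩ := Metric.isBounded_iff.1 hcomp.isBounded
    exact ⟨D, fun x hx y hy => by simpa [dist_eq_norm] using hD hx hy⟩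
  have hL0 : 0 < L := by rw [hL]; positivity
  set B := L₁₂ ^ 2 / (2 * μ)
  have hB : 0 ≤ B := by positivity
  set κ := L₂₂ / μ
  have hκ : 0 < κ := by positivity
  set k := 2 * κ + L₁₁ / 2 + 2 * B + 2 * (D * L) ^ 2 + 2 * D ^ 2 + 4 * L₂₂
  have hk : 0 < k := by positivity
  refine ⟨1 + 4 * k / L₁₁ + k * (1 + 4 * b / L₁₁), by positivity, fun ε hε hε1 =>
    ⟨1 + 4 * k / L₁₁ / ε, by positivity, ?_, fun δ hδ θ G => ?_⟩⟩
  · rw [add_div, add_div]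
    have h1 : 1 ≤ 1 / ε := (one_le_div hε).2 hε1.le
    have : 0 ≤ k * (1 + 4 * b / L₁₁) / ε := by positivity
    linarith
  have h1 := fospGap_le_of_proj_step hconv hcomp hPL hLip hL₂₂ hL0 hD hδ θ G
  have h2 := hdesc δ hδ θ G
  set p := proj Δ (δ - (1 / L) • G) with hp
  have hpm : p ∈ Δ := proj_mem hcomp ⟨δ, hδ⟩ _
  have h3 := subopt_le_of_mem hPL hLip hμ hL₂₂ one_pos hδ hpm θ
  set e := ‖G - gradδ f δ θ‖
  set r := ‖p - δ‖
  have h0 := hPL.subopt_nonneg hδ θ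
  set h := subopt f δ θ with hh
  set w := maxVal f δ - maxVal f p
  have h4 : f δ θ - f p θ = w - h + subopt f p θ := by simp only [w, hh, subopt]; ring
  have h5 := mul_le_add_sq_div hε (D * L * r)
  have h6 := mul_le_add_sq_div hε (D * e)
  have h7 := mul_le_add_sq_div hε √(2 * L₂₂ * h)
  rw [Real.sq_sqrt (by positivity)] at h7
  have hle : ∀ x : ℝ, 0 ≤ x → x ≤ x / ε := fun x hx => le_div_self hx hε hε1.le
  have h8 := hle (2 * κ * h) (by positivity)
  have h9 := hle ((L₁₁ / 2 + 2 * B) * r ^ 2) (by positivity)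
  have h10 : fospGap f Δ δ θ ≤ ε / 2 + w + k * (r ^ 2 + h + e ^ 2) / ε := by
    have h11 : (2 * κ * h) / ε + (L₁₁ / 2 + 2 * B) * r ^ 2 / ε + 2 * (D * L * r) ^ 2 / ε
        + 2 * (D * e) ^ 2 / ε + 2 * (2 * L₂₂ * h) / ε ≤ k * (r ^ 2 + h + e ^ 2) / ε := by
      rw [← add_div, ← add_div, ← add_div, ← add_div]
      gcongr
      have : k * (r ^ 2 + h + e ^ 2) - (2 * κ * h + (L₁₁ / 2 + 2 * B) * r ^ 2
          + 2 * (D * L * r) ^ 2 + 2 * (D * e) ^ 2 + 2 * (2 * L₂₂ * h))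
          = (2 * κ + 2 * D ^ 2 + 4 * L₂₂) * r ^ 2
            + (L₁₁ / 2 + 2 * B + 2 * (D * L) ^ 2 + 2 * D ^ 2) * h
            + (2 * κ + L₁₁ / 2 + 2 * B + 2 * (D * L) ^ 2 + 4 * L₂₂) * e ^ 2 := by
        simp only [k]; ring
      have : 0 ≤ (2 * κ + 2 * D ^ 2 + 4 * L₂₂) * r ^ 2
            + (L₁₁ / 2 + 2 * B + 2 * (D * L) ^ 2 + 2 * D ^ 2) * h
            + (2 * κ + L₁₁ / 2 + 2 * B + 2 * (D * L) ^ 2 + 4 * L₂₂) * e ^ 2 := by positivity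
      linarith
    rw [inv_one] at h3
    linarith
  have h12 : r ^ 2 ≤ 4 / L₁₁ * (w + b * (h + e ^ 2)) := by
    rw [div_mul_eq_mul_div, le_div_iff₀ hL₁₁]
    linarith
  have h13 : k * (r ^ 2 + h + e ^ 2) / ε
      ≤ k * (4 / L₁₁ * (w + b * (h + e ^ 2)) + h + e ^ 2) / ε := by gcongr
  have h14 : 0 ≤ (1 + 4 * k / L₁₁) / ε * (h + e ^ 2) := by positivity
  refine h10.trans ((add_le_add_right h13 _).trans ?_)
  rw [← sub_nonneg]
  refine h14.trans_eq ?_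
  field_simp
  ring

end Step

section Measurability

variable {f : Vec n → Vec d → ℝ} {Δ : Set (Vec n)} {μ L₁₁ L₁₂ L₂₂ : ℝ}

theorem LipschitzGradients.continuous (hLip : LipschitzGradients f Δ L₁₁ L₁₂ L₂₂) :
    Continuous fun x : Vec n × Vec d => f x.1 x.2 := hLip.contDiff.continuous

theorem LipschitzGradients.continuous_gradδ (hLip : LipschitzGradients f Δ L₁₁ L₁₂ L₂₂) :
    Continuous fun x : Vec n × Vec d => gradδ f x.1 x.2 := by
  have h : ∀ x : Vec n × Vec d, gradδ f x.1 x.2 = (InnerProductSpace.toDual ℝ (Vec n)).symm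
      ((fderiv ℝ (fun x : Vec n × Vec d => f x.1 x.2) x).comp
        (ContinuousLinearMap.inl ℝ (Vec n) (Vec d))) := by
    intro x
    rw [gradδ, gradient]
    congr 1
    exact ((hLip.contDiff.differentiable one_ne_zero x).hasFDerivAt.comp (f := fun δ => (δ, x.2)) x.1
      (hasFDerivAt_prodMk_left x.1 x.2)).fderiv
  simp_rw [h]
  exact (LinearIsometryEquiv.continuous _).comp
    ((hLip.contDiff.continuous_fderiv one_ne_zero).clm_comp continuous_const)

theorem LipschitzGradients.continuous_gradθ (hLip : LipschitzGradients f Δ L₁₁ L₁₂ L₂₂) :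
    Continuous fun x : Vec n × Vec d => gradθ f x.1 x.2 := by
  have h : ∀ x : Vec n × Vec d, gradθ f x.1 x.2 = (InnerProductSpace.toDual ℝ (Vec d)).symm
      ((fderiv ℝ (fun x : Vec n × Vec d => f x.1 x.2) x).comp
        (ContinuousLinearMap.inr ℝ (Vec n) (Vec d))) := by
    intro x
    rw [gradθ, gradient]
    congr 1
    exact ((hLip.contDiff.differentiable one_ne_zero x).hasFDerivAt.comp (f := fun θ => (x.1, θ)) x.2
      (hasFDerivAt_prodMk_right x.1 x.2)).fderiv
  simp_rw [h]
  exact (LinearIsometryEquiv.continuous _).comp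
    ((hLip.contDiff.continuous_fderiv one_ne_zero).clm_comp continuous_const)

theorem measurable_maxVal_proj (hconv : Convex ℝ Δ) (hcomp : IsCompact Δ) (hne : Δ.Nonempty)
    (hPL : MinmaxPL f Δ μ) (hLip : LipschitzGradients f Δ L₁₁ L₁₂ L₂₂) :
    Measurable fun δ => maxVal f (proj Δ δ) := by
  refine LowerSemicontinuous.measurable (lowerSemicontinuous_ciSup
    (fun δ => hPL.bddAbove (proj_mem hcomp hne δ)) fun θ => Continuous.lowerSemicontinuous ?_)
  exact hLip.continuous.comp ((continuous_proj hconv hcomp hne).prodMk continuous_const)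

/-- The part of the stationarity gap that belongs to `δ` is measurable. -/
theorem measurable_sSup_neg_inner (hconv : Convex ℝ Δ) (hcomp : IsCompact Δ) (hne : Δ.Nonempty) :
    Measurable fun x : Vec n × Vec n => sSup ((fun δ' => -inner ℝ x.2 (δ' - proj Δ x.1)) ''
      {δ' | δ' ∈ Δ ∧ ‖δ' - proj Δ x.1‖ ≤ 1}) := by
  have hp := continuous_proj hconv hcomp hne
  have : CompactSpace Δ := isCompact_iff_compactSpace.1 hcomp
  refine measurable_of_Ici fun c => IsClosed.measurableSet ?_
  have hS : IsClosed {z : Δ × (Vec n × Vec n) | ‖(z.1 : Vec n) - proj Δ z.2.1‖ ≤ 1 ∧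
      c ≤ -inner ℝ z.2.2 ((z.1 : Vec n) - proj Δ z.2.1)} :=
    IsClosed.and (isClosed_le (by fun_prop) continuous_const)
      (isClosed_le continuous_const (by fun_prop))
  convert isClosedMap_snd_of_compactSpace _ hS using 1
  ext x
  have hK : IsCompact {δ' | δ' ∈ Δ ∧ ‖δ' - proj Δ x.1‖ ≤ 1} :=
    hcomp.inter_right (t := {δ' | ‖δ' - proj Δ x.1‖ ≤ 1})
      (isClosed_le (by fun_prop) continuous_const)
  have hK0 : {δ' | δ' ∈ Δ ∧ ‖δ' - proj Δ x.1‖ ≤ 1}.Nonempty :=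
    ⟨proj Δ x.1, proj_mem hcomp hne _, by simp⟩
  have hI := hK.image (f := fun δ' => -inner ℝ x.2 (δ' - proj Δ x.1)) (by fun_prop)
  constructor
  · intro hx
    obtain ⟨z, ⟨hz, hz1⟩, hz2⟩ := hI.sSup_mem (hK0.image _)
    exact ⟨(⟨z, hz⟩, x), ⟨hz1, (Set.mem_Ici.1 hx).trans_eq hz2.symm⟩, rfl⟩
  · rintro ⟨⟨z, y⟩, ⟨hz1, hz2⟩, rfl⟩
    exact hz2.trans (le_csSup hI.bddAbove ⟨z, ⟨z.2, hz1⟩, rfl⟩)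

theorem fospGap_nonneg {δ : Vec n} (hδ : δ ∈ Δ) (θ : Vec d) :
    0 ≤ fospGap f Δ δ θ := by
  have := ((isFOSP_iff_fospGap_le f Δ _ hδ θ).2 le_rfl).2.2 θ (by simp)
  simpa using this

theorem sSup_inner_sub_eq_norm {m : ℕ} (g θ : Vec m) :
    sSup ((fun θ' => inner ℝ g (θ' - θ)) '' {θ' | ‖θ' - θ‖ ≤ 1}) = ‖g‖ := by
  refine IsGreatest.csSup_eq ⟨⟨θ + ‖g‖⁻¹ • g, ?_, ?_⟩, ?_⟩
  · rw [Set.mem_ofPred_eq, add_sub_cancel_left, norm_smul, norm_inv, norm_norm]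
    exact inv_mul_le_one
  · simp only [add_sub_cancel_left, inner_smul_right, real_inner_self_eq_norm_sq, sq]
    rcases eq_or_ne ‖g‖ 0 with h | h
    · simp [h]
    · field_simp
  · rintro _ ⟨y, hy, rfl⟩
    exact (real_inner_le_norm _ _).trans (mul_le_of_le_one_right (norm_nonneg _) hy)

theorem measurable_fospGap_proj (hconv : Convex ℝ Δ) (hcomp : IsCompact Δ) (hne : Δ.Nonempty)
    (hLip : LipschitzGradients f Δ L₁₁ L₁₂ L₂₂) :
    Measurable fun x : Vec n × Vec d => fospGap f Δ (proj Δ x.1) x.2 := by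
  have hp := continuous_proj hconv hcomp hne
  have hq : Continuous fun x : Vec n × Vec d => (proj Δ x.1, x.2) := by fun_prop
  have h1 : Measurable fun x : Vec n × Vec d => gradδ f (proj Δ x.1) x.2 :=
    (hLip.continuous_gradδ.comp hq).measurable
  have h2 : Measurable fun x : Vec n × Vec d => ‖gradθ f (proj Δ x.1) x.2‖ :=
    (hLip.continuous_gradθ.comp hq).norm.measurable
  simp only [fospGap, sSup_inner_sub_eq_norm]
  have h3 : Measurable fun x : Vec n × Vec d => (x.1, gradδ f (proj Δ x.1) x.2) :=
    measurable_fst.prodMk h1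
  have h4 := (measurable_sSup_neg_inner hconv hcomp hne).comp h3
  exact h4.max h2

end Measurability

/-- A bound on the conditional expectation of a nonnegative function of `(X, Y)` bounds its
expectation. -/
theorem integrable_and_integral_le_of_hasCondDistrib {Ω 𝓧 𝓨 : Type*} [MeasurableSpace Ω]
    [MeasurableSpace 𝓧] [MeasurableSpace 𝓨] {Pr : Measure Ω} [IsProbabilityMeasure Pr]
    {X : Ω → 𝓧} {Y : Ω → 𝓨} {κ : Kernel 𝓧 𝓨} [IsMarkovKernel κ] (h : HasCondDistrib Y X κ Pr)
    {F : 𝓧 × 𝓨 → ℝ} (hF : Measurable F) (hF0 : ∀ z, 0 ≤ F z) {v : ℝ} (hv : 0 ≤ v)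
    (hi : ∀ ω, Integrable (fun y => F (X ω, y)) (κ (X ω)))
    (hle : ∀ ω, ∫ y, F (X ω, y) ∂(κ (X ω)) ≤ v) :
    Integrable (fun ω => F (X ω, Y ω)) Pr ∧ ∫ ω, F (X ω, Y ω) ∂Pr ≤ v := by
  have hXY := h.aemeasurable
  have hX : AEMeasurable X Pr := h.aemeasurable_fst
  have hF' : Measurable fun z => ENNReal.ofReal (F z) := hF.ennreal_ofReal
  have hm : AEMeasurable (fun ω => F (X ω, Y ω)) Pr := hF.comp_aemeasurable hXY
  have key : ∫⁻ ω, ENNReal.ofReal (F (X ω, Y ω)) ∂Pr ≤ ENNReal.ofReal v := calc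
    _ = ∫⁻ z, ENNReal.ofReal (F z) ∂(Pr.map fun ω => (X ω, Y ω)) :=
      (lintegral_map' hF'.aemeasurable hXY).symm
    _ = ∫⁻ x, ∫⁻ y, ENNReal.ofReal (F (x, y)) ∂(κ x) ∂(Pr.map X) := by
      rw [h.map_eq, Measure.lintegral_compProd hF']
    _ = ∫⁻ ω, ∫⁻ y, ENNReal.ofReal (F (X ω, y)) ∂(κ (X ω)) ∂Pr :=
      lintegral_map' (Measurable.lintegral_kernel_prod_right' hF').aemeasurable hX
    _ ≤ ∫⁻ _, ENNReal.ofReal v ∂Pr := by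
      refine lintegral_mono fun ω => ?_
      rw [← ofReal_integral_eq_lintegral_ofReal (hi ω) (Filter.Eventually.of_forall fun _ => hF0 _)]
      exact ENNReal.ofReal_le_ofReal (hle ω)
    _ = ENNReal.ofReal v := by simp
  have h0 : 0 ≤ᵐ[Pr] fun ω => F (X ω, Y ω) := Filter.Eventually.of_forall fun _ => hF0 _
  refine ⟨⟨hm.aestronglyMeasurable, ?_⟩, ?_⟩
  · rw [hasFiniteIntegral_iff_ofReal h0]
    exact key.trans_lt ENNReal.ofReal_lt_top
  · rw [integral_eq_lintegral_of_nonneg_ae h0 hm.aestronglyMeasurable]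
    exact ENNReal.toReal_le_of_le_ofReal hv key

/-- The squared error of a pair of stochastic gradients. -/
noncomputable def sqNoise {Ξ : Type*} (f : Vec n → Vec d → ℝ) (Gδ : Vec n → Vec d → Ξ → Vec n)
    (Gθ : Vec n → Vec d → Ξ → Vec d) (z : (Vec n × Vec d) × Ξ) : ℝ :=
  ‖Gδ z.1.1 z.1.2 z.2 - gradδ f z.1.1 z.1.2‖ ^ 2 + ‖Gθ z.1.1 z.1.2 z.2 - gradθ f z.1.1 z.1.2‖ ^ 2

theorem measurable_sqNoise {Ξ : Type*} [MeasurableSpace Ξ] {f : Vec n → Vec d → ℝ}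
    {Δ : Set (Vec n)} {L₁₁ L₁₂ L₂₂ v : ℝ} {P : Kernel (Vec n × Vec d) Ξ}
    {Gδ : Vec n → Vec d → Ξ → Vec n} {Gθ : Vec n → Vec d → Ξ → Vec d}
    (hLip : LipschitzGradients f Δ L₁₁ L₁₂ L₂₂)
    (hG : StochasticGradients f Δ P Gδ Gθ v) : Measurable (sqNoise f Gδ Gθ) := by
  have h1 : Measurable fun z : (Vec n × Vec d) × Ξ => gradδ f z.1.1 z.1.2 :=
    hLip.continuous_gradδ.measurable.comp measurable_fst
  have h2 : Measurable fun z : (Vec n × Vec d) × Ξ => gradθ f z.1.1 z.1.2 :=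
    hLip.continuous_gradθ.measurable.comp measurable_fst
  exact ((hG.measurable_δ.sub h1).norm.pow_const 2).add ((hG.measurable_θ.sub h2).norm.pow_const 2)

theorem sqNoise_nonneg {Ξ : Type*} {f : Vec n → Vec d → ℝ} {Gδ : Vec n → Vec d → Ξ → Vec n}
    {Gθ : Vec n → Vec d → Ξ → Vec d} (z : (Vec n × Vec d) × Ξ) : 0 ≤ sqNoise f Gδ Gθ z := by
  unfold sqNoise; positivity

theorem aemeasurable_subopt {Ω : Type*} [MeasurableSpace Ω] {Pr : Measure Ω}
    {f : Vec n → Vec d → ℝ} {Δ : Set (Vec n)} {μ L₁₁ L₁₂ L₂₂ : ℝ} (hconv : Convex ℝ Δ) (hcomp : IsCompact Δ) (hne : Δ.Nonempty)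
    (hPL : MinmaxPL f Δ μ) (hLip : LipschitzGradients f Δ L₁₁ L₁₂ L₂₂)
    {x : Ω → Vec n × Vec d} (hx : AEMeasurable x Pr) (hxΔ : ∀ ω, (x ω).1 ∈ Δ) :
    AEMeasurable (fun ω => subopt f (x ω).1 (x ω).2) Pr := by
  have h1 := (measurable_maxVal_proj hconv hcomp hne hPL hLip).comp_aemeasurable hx.fst
  have h2 := hLip.continuous.measurable.comp_aemeasurable hx
  have h3 := h1.sub h2
  convert h3 using 2 with ω
  simp [subopt, proj_of_mem hcomp (hxΔ ω)]

section Iterates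

variable {Ξ : Type*} {Δ : Set (Vec n)} {Gδ : Vec n → Vec d → Ξ → Vec n}
  {Gθ : Vec n → Vec d → Ξ → Vec d} {η₁ η₂ : ℝ} {K : ℕ} {δ₀ : Vec n} {θ₀ : Vec d}
  {ξ : ℕ → ℕ → Ξ}

theorem outerIter_fst_mem (hcomp : IsCompact Δ) (hδ₀ : δ₀ ∈ Δ) (t : ℕ) :
    (outerIter Δ Gδ Gθ η₁ η₂ K δ₀ θ₀ ξ t).1 ∈ Δ := by
  cases t with
  | zero => exact hδ₀
  | succ t => exact proj_mem hcomp ⟨δ₀, hδ₀⟩ _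

theorem attackIter_fst_mem (hcomp : IsCompact Δ) (hδ₀ : δ₀ ∈ Δ) (t k : ℕ) :
    (attackIter Δ Gδ Gθ η₁ η₂ K δ₀ θ₀ ξ t k).1 ∈ Δ :=
  outerIter_fst_mem hcomp hδ₀ t

end Iterates

section Expectation

variable {Ξ Ω : Type*} [MeasurableSpace Ξ] [MeasurableSpace Ω] {f : Vec n → Vec d → ℝ}
  {Δ : Set (Vec n)} {μ L₁₁ L₁₂ L₂₂ : ℝ} {P : Kernel (Vec n × Vec d) Ξ} [IsMarkovKernel P]
  {Gδ : Vec n → Vec d → Ξ → Vec n} {Gθ : Vec n → Vec d → Ξ → Vec d} {v : ℝ}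
  {Pr : Measure Ω} [IsProbabilityMeasure Pr] {η₁ η₂ : ℝ} {N K : ℕ} {δ₀ : Vec n} {θ₀ : Vec d}
  {ξ : ℕ → ℕ → Ω → Ξ}

theorem IsAttackSampling.hasCondDistrib
    (hξ : IsAttackSampling Pr Δ P Gδ Gθ η₁ η₂ N K δ₀ θ₀ ξ) {t k : ℕ} (ht : t < N) (hk : k ≤ K) :
    HasCondDistrib (ξ t k)
      (fun ω => attackIter Δ Gδ Gθ η₁ η₂ K δ₀ θ₀ (fun s j => ξ s j ω) t k) P Pr :=
  (hξ t ht k hk).comp_right (hf := measurable_snd)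

theorem integrable_sqNoise_and_integral_le (hcomp : IsCompact Δ) (hδ₀ : δ₀ ∈ Δ)
    (hLip : LipschitzGradients f Δ L₁₁ L₁₂ L₂₂) (hv : 0 ≤ v)
    (hG : StochasticGradients f Δ P Gδ Gθ v)
    (hξ : IsAttackSampling Pr Δ P Gδ Gθ η₁ η₂ N K δ₀ θ₀ ξ) {t k : ℕ} (ht : t < N) (hk : k ≤ K) :
    Integrable (fun ω => sqNoise f Gδ Gθ
      (attackIter Δ Gδ Gθ η₁ η₂ K δ₀ θ₀ (fun s j => ξ s j ω) t k, ξ t k ω)) Pr ∧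
    ∫ ω, sqNoise f Gδ Gθ
      (attackIter Δ Gδ Gθ η₁ η₂ K δ₀ θ₀ (fun s j => ξ s j ω) t k, ξ t k ω) ∂Pr ≤ v :=
  integrable_and_integral_le_of_hasCondDistrib (hξ.hasCondDistrib ht hk)
    (measurable_sqNoise hLip hG) sqNoise_nonneg hv
    (fun _ => hG.integrable_sq _ (attackIter_fst_mem hcomp hδ₀ t k) _)
    (fun _ => hG.variance_le _ (attackIter_fst_mem hcomp hδ₀ t k) _)

/-- The suboptimality along the inner loop, in expectation. -/
theorem integrable_subopt_inner (hconv : Convex ℝ Δ) (hcomp : IsCompact Δ) (hδ₀ : δ₀ ∈ Δ)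
    (hPL : MinmaxPL f Δ μ) (hLip : LipschitzGradients f Δ L₁₁ L₁₂ L₂₂) (hμ : 0 < μ)
    (hL₂₂ : 0 < L₂₂) (hη₁ : η₁ = 1 / L₂₂) (hv : 0 ≤ v)
    (hG : StochasticGradients f Δ P Gδ Gθ v)
    (hξ : IsAttackSampling Pr Δ P Gδ Gθ η₁ η₂ N K δ₀ θ₀ ξ) {t : ℕ} (ht : t < N)
    {x : ℕ → Ω → Vec n × Vec d}
    (hx : x = fun k ω => attackIter Δ Gδ Gθ η₁ η₂ K δ₀ θ₀ (fun s j => ξ s j ω) t k)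
    (h0 : Integrable (fun ω => subopt f (x 0 ω).1 (x 0 ω).2) Pr) {k : ℕ} (hk : k ≤ K) :
    Integrable (fun ω => subopt f (x k ω).1 (x k ω).2) Pr ∧
    ∫ ω, subopt f (x k ω).1 (x k ω).2 ∂Pr
      ≤ (1 - min μ L₂₂ / L₂₂) ^ k * ∫ ω, subopt f (x 0 ω).1 (x 0 ω).2 ∂Pr
        + v / (2 * min μ L₂₂) := by
  have hm : 0 < min μ L₂₂ := lt_min hμ hL₂₂
  have hq : 0 ≤ 1 - min μ L₂₂ / L₂₂ := by
    rw [sub_nonneg, div_le_one hL₂₂]; exact min_le_right _ _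
  have hxΔ : ∀ k ω, (x k ω).1 ∈ Δ := fun k ω => by
    rw [hx]; exact attackIter_fst_mem hcomp hδ₀ t k
  induction k with
  | zero =>
    refine ⟨h0, ?_⟩
    have : 0 ≤ v / (2 * min μ L₂₂) := by positivity
    simpa using this
  | succ k ih =>
    obtain ⟨hi, hle⟩ := ih (Nat.le_of_succ_le hk)
    obtain ⟨hni, hnle⟩ := integrable_sqNoise_and_integral_le hcomp hδ₀ hLip hv hG hξ ht
      (Nat.le_of_succ_le hk)
    have hstep : ∀ ω, subopt f (x (k + 1) ω).1 (x (k + 1) ω).2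
        ≤ (1 - min μ L₂₂ / L₂₂) * subopt f (x k ω).1 (x k ω).2
          + sqNoise f Gδ Gθ (attackIter Δ Gδ Gθ η₁ η₂ K δ₀ θ₀ (fun s j => ξ s j ω) t k, ξ t k ω)
            / (2 * L₂₂) := by
      intro ω
      have h1 : x (k + 1) ω = ((x k ω).1,
          (x k ω).2 + (1 / L₂₂) • Gθ (x k ω).1 (x k ω).2 (ξ t k ω)) := by
        rw [hx, hη₁]; rfl
      have h2 := subopt_add_smul_le_mul hPL hLip hL₂₂ (hxΔ k ω) (x k ω).2
        (Gθ (x k ω).1 (x k ω).2 (ξ t k ω))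
      rw [h1]
      refine h2.trans ?_
      have h3 : attackIter Δ Gδ Gθ η₁ η₂ K δ₀ θ₀ (fun s j => ξ s j ω) t k = x k ω := by rw [hx]
      rw [h3]
      gcongr
      exact le_add_of_nonneg_left (sq_nonneg _)
    have hbi := (hi.const_mul (1 - min μ L₂₂ / L₂₂)).add (hni.div_const (2 * L₂₂))
    have hxm : AEMeasurable (x (k + 1)) Pr := by
      rw [hx]; exact (hξ.hasCondDistrib ht hk).aemeasurable_fst
    have hint : Integrable (fun ω => subopt f (x (k + 1) ω).1 (x (k + 1) ω).2) Pr := by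
      refine hbi.mono' (aemeasurable_subopt hconv hcomp ⟨δ₀, hδ₀⟩ hPL hLip hxm
        (hxΔ _)).aestronglyMeasurable (Filter.Eventually.of_forall fun ω => ?_)
      rw [Real.norm_of_nonneg (hPL.subopt_nonneg (hxΔ _ ω) _)]
      exact hstep ω
    refine ⟨hint, ?_⟩
    have h4 := integral_mono hint hbi hstep
    simp only [Pi.add_apply] at h4
    rw [integral_add (hi.const_mul _) (hni.div_const _), integral_const_mul, integral_div] at h4
    have h5 := mul_le_mul_of_nonneg_left hle hq
    have h6 := div_le_div_of_nonneg_right hnle (by positivity : 0 ≤ 2 * L₂₂)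
    have h7 : (1 - min μ L₂₂ / L₂₂) * (v / (2 * min μ L₂₂)) + v / (2 * L₂₂)
        = v / (2 * min μ L₂₂) := by
      field_simp
      ring
    rw [pow_succ']
    linarith

/-- The suboptimality stays bounded in expectation, provided the inner loop is long enough. -/
theorem integrable_subopt_outer (hconv : Convex ℝ Δ) (hcomp : IsCompact Δ) (hδ₀ : δ₀ ∈ Δ)
    (hPL : MinmaxPL f Δ μ) (hLip : LipschitzGradients f Δ L₁₁ L₁₂ L₂₂) (hμ : 0 < μ)
    (hL₂₂ : 0 < L₂₂) (hη₁ : η₁ = 1 / L₂₂) (hv : 0 ≤ v)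
    (hG : StochasticGradients f Δ P Gδ Gθ v)
    (hξ : IsAttackSampling Pr Δ P Gδ Gθ η₁ η₂ N K δ₀ θ₀ ξ)
    {D A : ℝ} (hD : ∀ x ∈ Δ, ∀ y ∈ Δ, ‖x - y‖ ≤ D) (hA0 : subopt f δ₀ θ₀ ≤ A)
    (hK : 4 * (L₂₂ / μ) * (1 - min μ L₂₂ / L₂₂) ^ K ≤ 1)
    (hA : 2 * (L₂₂ / μ * (v / min μ L₂₂) + L₁₂ ^ 2 / μ * D ^ 2) ≤ A)
    {x : ℕ → ℕ → Ω → Vec n × Vec d}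
    (hx : x = fun t k ω => attackIter Δ Gδ Gθ η₁ η₂ K δ₀ θ₀ (fun s j => ξ s j ω) t k)
    {t : ℕ} (ht : t < N) :
    Integrable (fun ω => subopt f (x t 0 ω).1 (x t 0 ω).2) Pr ∧
    ∫ ω, subopt f (x t 0 ω).1 (x t 0 ω).2 ∂Pr ≤ A := by
  have hxΔ : ∀ t k ω, (x t k ω).1 ∈ Δ := fun t k ω => by
    rw [hx]; exact attackIter_fst_mem hcomp hδ₀ t k
  have hm : 0 < min μ L₂₂ := lt_min hμ hL₂₂
  induction t with
  | zero =>
    have h1 : ∀ ω, x 0 0 ω = (δ₀, θ₀) := fun ω => by rw [hx]; rfl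
    simp only [h1]
    exact ⟨integrable_const _, by simpa using hA0⟩
  | succ t ih =>
    have ht' : t < N := Nat.lt_of_succ_lt ht
    obtain ⟨h0, hle0⟩ := ih ht'
    obtain ⟨hi, hle⟩ := integrable_subopt_inner hconv hcomp hδ₀ hPL hLip hμ hL₂₂ hη₁ hv hG hξ ht'
      (x := x t) (by rw [hx]) h0 le_rfl
    have hstep : ∀ ω, subopt f (x (t + 1) 0 ω).1 (x (t + 1) 0 ω).2
        ≤ 2 * (L₂₂ / μ) * subopt f (x t K ω).1 (x t K ω).2 + L₁₂ ^ 2 / μ * D ^ 2 := by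
      intro ω
      have h1 : (x (t + 1) 0 ω).2 = (x t K ω).2 := by rw [hx]; rfl
      have h2 := subopt_le_of_mem hPL hLip hμ hL₂₂ one_pos (hxΔ t K ω) (hxΔ (t + 1) 0 ω) (x t K ω).2
      have h3 : ‖(x (t + 1) 0 ω).1 - (x t K ω).1‖ ^ 2 ≤ D ^ 2 :=
        pow_le_pow_left₀ (norm_nonneg _) (hD _ (hxΔ _ _ _) _ (hxΔ _ _ _)) 2
      have h4 := mul_le_mul_of_nonneg_left h3 (by positivity : 0 ≤ L₁₂ ^ 2 / μ)
      have h5 : (1 + 1) * (L₁₂ ^ 2 / (2 * μ)) = L₁₂ ^ 2 / μ := by field_simp; ring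
      rw [h5] at h2
      rw [inv_one] at h2
      rw [h1]
      linarith
    have hbi := (hi.const_mul (2 * (L₂₂ / μ))).add (integrable_const (μ := Pr) (L₁₂ ^ 2 / μ * D ^ 2))
    have hxm : AEMeasurable (x (t + 1) 0) Pr := by
      rw [hx]; exact (hξ.hasCondDistrib ht (Nat.zero_le K)).aemeasurable_fst
    have hint : Integrable (fun ω => subopt f (x (t + 1) 0 ω).1 (x (t + 1) 0 ω).2) Pr := by
      refine hbi.mono' (aemeasurable_subopt hconv hcomp ⟨δ₀, hδ₀⟩ hPL hLip hxm
        (hxΔ _ _)).aestronglyMeasurable (Filter.Eventually.of_forall fun ω => ?_)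
      rw [Real.norm_of_nonneg (hPL.subopt_nonneg (hxΔ _ _ ω) _)]
      exact hstep ω
    refine ⟨hint, ?_⟩
    have h4 := integral_mono hint hbi hstep
    simp only [Pi.add_apply] at h4
    rw [integral_add (hi.const_mul _) (integrable_const _), integral_const_mul] at h4
    simp only [integral_const, probReal_univ, smul_eq_mul, one_mul] at h4
    have hq : 0 ≤ 1 - min μ L₂₂ / L₂₂ := by
      rw [sub_nonneg, div_le_one hL₂₂]; exact min_le_right _ _
    have h5 := mul_le_mul_of_nonneg_left hle (by positivity : 0 ≤ 2 * (L₂₂ / μ))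
    have hI0 : 0 ≤ ∫ ω, subopt f (x t 0 ω).1 (x t 0 ω).2 ∂Pr :=
      integral_nonneg fun ω => hPL.subopt_nonneg (hxΔ _ _ ω) _
    have h6 := mul_le_mul_of_nonneg_right hK hI0
    have h7 : v / (2 * min μ L₂₂) = v / min μ L₂₂ / 2 := by field_simp
    rw [h7] at h5
    linarith

end Expectation

theorem exists_abs_maxVal_le {f : Vec n → Vec d → ℝ} {Δ : Set (Vec n)} {μ L₁₁ L₁₂ L₂₂ : ℝ}
    (hcomp : IsCompact Δ) (hPL : MinmaxPL f Δ μ)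
    (hLip : LipschitzGradients f Δ L₁₁ L₁₂ L₂₂) (hμ : 0 < μ) (hL₂₂ : 0 < L₂₂)
    {D : ℝ} (hD : ∀ x ∈ Δ, ∀ y ∈ Δ, ‖x - y‖ ≤ D) {δ₀ : Vec n} (hδ₀ : δ₀ ∈ Δ) :
    ∃ B : ℝ, ∀ δ ∈ Δ, |maxVal f δ| ≤ B := by
  obtain ⟨b, hb⟩ := hcomp.exists_bound_of_continuousOn (f := fun δ => f δ 0)
    (hLip.differentiable_left 0).continuous.continuousOn
  refine ⟨b + (2 * (L₂₂ / μ) * subopt f δ₀ 0 + L₁₂ ^ 2 / μ * D ^ 2), fun δ hδ => ?_⟩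
  have h1 := subopt_le_of_mem hPL hLip hμ hL₂₂ one_pos hδ₀ hδ 0
  have h2 := hPL.subopt_nonneg hδ 0
  have h3 : maxVal f δ = f δ 0 + subopt f δ 0 := by simp [subopt]
  have h4 : ‖δ - δ₀‖ ^ 2 ≤ D ^ 2 := pow_le_pow_left₀ (norm_nonneg _) (hD _ hδ _ hδ₀) 2
  have h5 := mul_le_mul_of_nonneg_left h4 (by positivity : 0 ≤ L₁₂ ^ 2 / μ)
  have h6 : (1 + 1) * (L₁₂ ^ 2 / (2 * μ)) = L₁₂ ^ 2 / μ := by field_simp; ring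
  rw [h6, inv_one] at h1
  rw [h3]
  refine (abs_add_le _ _).trans (add_le_add (hb δ hδ) ?_)
  rw [abs_of_nonneg h2]
  linarith

theorem one_sub_pow_le {s C ε : ℝ} (hs : s ≤ 1) (hC : 2 ≤ s * C) (hε : 0 < ε) (hε1 : ε < 1)
    {K : ℕ} (hs0 : 0 ≤ s) (hK : C * (1 + Real.log ε⁻¹) ≤ K) :
    (1 - s) ^ K ≤ ε ^ 2 / (s * C) := by
  have hlog : 0 ≤ Real.log ε⁻¹ := Real.log_nonneg ((one_le_inv₀ hε).2 hε1.le)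
  have h0 : 0 < s * C := by linarith
  calc (1 - s) ^ K ≤ Real.exp (-s) ^ K :=
        pow_le_pow_left₀ (by linarith) (Real.one_sub_le_exp_neg s) K
    _ = Real.exp (-(s * K)) := by rw [← Real.exp_nat_mul]; congr 1; ring
    _ ≤ Real.exp (-(s * C) + 2 * Real.log ε) := by
        apply Real.exp_le_exp.2
        have h1 := mul_le_mul_of_nonneg_left hK hs0
        have h2 := mul_le_mul_of_nonneg_right hC hlog
        rw [Real.log_inv] at h1 h2
        nlinarith
    _ = (Real.exp (s * C))⁻¹ * ε ^ 2 := by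
        rw [Real.exp_add, Real.exp_neg, two_mul, Real.exp_add, Real.exp_log hε, sq]
    _ ≤ (s * C)⁻¹ * ε ^ 2 := by
        gcongr
        linarith [Real.add_one_le_exp (s * C)]
    _ = ε ^ 2 / (s * C) := by rw [div_eq_inv_mul]

theorem integrable_fospGap {Ω : Type*} [MeasurableSpace Ω] {Pr : Measure Ω}
    {f : Vec n → Vec d → ℝ} {Δ : Set (Vec n)} {L₁₁ L₁₂ L₂₂ : ℝ} (hconv : Convex ℝ Δ) (hcomp : IsCompact Δ) (hne : Δ.Nonempty)
    (hLip : LipschitzGradients f Δ L₁₁ L₁₂ L₂₂) {x : Ω → Vec n × Vec d} (hx : AEMeasurable x Pr)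
    (hxΔ : ∀ ω, (x ω).1 ∈ Δ) {g : Ω → ℝ} (hg : Integrable g Pr)
    (hle : ∀ ω, fospGap f Δ (x ω).1 (x ω).2 ≤ g ω) :
    Integrable (fun ω => fospGap f Δ (x ω).1 (x ω).2) Pr := by
  have hm := (measurable_fospGap_proj hconv hcomp hne hLip).comp_aemeasurable hx
  simp only [Function.comp_def, proj_of_mem hcomp (hxΔ _)] at hm
  refine hg.mono' hm.aestronglyMeasurable (Filter.Eventually.of_forall fun ω => ?_)
  rw [Real.norm_of_nonneg (fospGap_nonneg (hxΔ ω) _)]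
  exact hle ω

section Expectation

variable {Ξ Ω : Type*} [MeasurableSpace Ξ] [MeasurableSpace Ω] {f : Vec n → Vec d → ℝ}
  {Δ : Set (Vec n)} {μ L₁₁ L₁₂ L₂₂ : ℝ} {P : Kernel (Vec n × Vec d) Ξ} [IsMarkovKernel P]
  {Gδ : Vec n → Vec d → Ξ → Vec n} {Gθ : Vec n → Vec d → Ξ → Vec d} {v : ℝ}
  {Pr : Measure Ω} [IsProbabilityMeasure Pr] {η₁ η₂ : ℝ} {N K : ℕ} {δ₀ : Vec n} {θ₀ : Vec d}
  {ξ : ℕ → ℕ → Ω → Ξ}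

theorem aemeasurable_outerIter_fst (hconv : Convex ℝ Δ) (hcomp : IsCompact Δ) (hδ₀ : δ₀ ∈ Δ)
    (hG : StochasticGradients f Δ P Gδ Gθ v)
    (hξ : IsAttackSampling Pr Δ P Gδ Gθ η₁ η₂ N K δ₀ θ₀ ξ) {t : ℕ} (ht : t ≤ N) :
    AEMeasurable (fun ω => (outerIter Δ Gδ Gθ η₁ η₂ K δ₀ θ₀ (fun s j => ξ s j ω) t).1) Pr := by
  cases t with
  | zero => exact aemeasurable_const
  | succ t =>
    have h := hξ.hasCondDistrib ht le_rfl
    have h1 := hG.measurable_δ.comp_aemeasurable h.aemeasurable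
    exact (continuous_proj hconv hcomp ⟨δ₀, hδ₀⟩).measurable.comp_aemeasurable
      (h.aemeasurable_fst.fst.sub (h1.const_smul η₂))

theorem integrable_maxVal_outerIter (hconv : Convex ℝ Δ) (hcomp : IsCompact Δ) (hδ₀ : δ₀ ∈ Δ)
    (hPL : MinmaxPL f Δ μ) (hLip : LipschitzGradients f Δ L₁₁ L₁₂ L₂₂)
    (hG : StochasticGradients f Δ P Gδ Gθ v)
    (hξ : IsAttackSampling Pr Δ P Gδ Gθ η₁ η₂ N K δ₀ θ₀ ξ)
    {B : ℝ} (hB : ∀ δ ∈ Δ, |maxVal f δ| ≤ B) {t : ℕ} (ht : t ≤ N) :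
    Integrable (fun ω => maxVal f
      (outerIter Δ Gδ Gθ η₁ η₂ K δ₀ θ₀ (fun s j => ξ s j ω) t).1) Pr := by
  have hm := (measurable_maxVal_proj hconv hcomp ⟨δ₀, hδ₀⟩ hPL hLip).comp_aemeasurable
    (aemeasurable_outerIter_fst hconv hcomp hδ₀ hG hξ ht)
  simp only [Function.comp_def, proj_of_mem hcomp (outerIter_fst_mem hcomp hδ₀ t)] at hm
  exact Integrable.of_bound hm.aestronglyMeasurable B
    (Filter.Eventually.of_forall fun ω => hB _ (outerIter_fst_mem hcomp hδ₀ t))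

end Expectation

theorem exists_lt_le_of_le_telescope {g Φ : ℕ → ℝ} {N : ℕ} {a b B ε : ℝ} (hN : 0 < N) (ha : 0 ≤ a)
    (hg : ∀ t < N, g t ≤ b + a * (Φ t - Φ (t + 1))) (hB : ∀ t, |Φ t| ≤ B)
    (hε : N * b + a * (2 * B) ≤ N * ε) : ∃ t < N, g t ≤ ε := by
  have h0 : (Finset.range N).Nonempty := ⟨0, Finset.mem_range.2 hN⟩
  have h1 : ∑ t ∈ Finset.range N, g t ≤ ∑ _t ∈ Finset.range N, ε := calc
    _ ≤ ∑ t ∈ Finset.range N, (b + a * (Φ t - Φ (t + 1))) :=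
      Finset.sum_le_sum fun t ht => hg t (Finset.mem_range.1 ht)
    _ = N * b + a * (Φ 0 - Φ N) := by
      rw [Finset.sum_add_distrib, ← Finset.mul_sum, Finset.sum_range_sub']
      simp
    _ ≤ N * b + a * (2 * B) := by
      have := (abs_le.1 (hB 0)).2
      have := (abs_le.1 (hB N)).1
      gcongr
      linarith
    _ ≤ _ := by simpa using hε
  obtain ⟨t, ht, h⟩ := Finset.exists_le_of_sum_le h0 h1
  exact ⟨t, Finset.mem_range.1 ht, h⟩

end SamplingAttack

theorem mainTheorem1 {n d : ℕ} (f : Vec n → Vec d → ℝ) (Δ : Set (Vec n))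
    (hconv : Convex ℝ Δ) (hcomp : IsCompact Δ)
    (μ L₁₁ L₁₂ L₂₂ σ : ℝ) (hμ : 0 < μ) (hL₁₁ : 0 < L₁₁) (hL₁₂ : 0 ≤ L₁₂) (hL₂₂ : 0 < L₂₂)
    (hPL : MinmaxPL f Δ μ) (hLip : LipschitzGradients f Δ L₁₁ L₁₂ L₂₂)
    (δ₀ : Vec n) (hδ₀ : δ₀ ∈ Δ) (θ₀ : Vec d)
    (L η₁ η₂ : ℝ) (hL : L = L₁₁ + L₁₂ ^ 2 / (2 * μ)) (hη₁ : η₁ = 1 / L₂₂) (hη₂ : η₂ = 1 / L) :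
    ∃ C : ℝ, 0 < C ∧ ∀ ε : ℝ, 0 < ε → ε < 1 → ∀ N K M : ℕ,
      C * ε⁻¹ ^ 2 ≤ N → C * (1 + Real.log ε⁻¹) ≤ K → C * ε⁻¹ ^ 4 ≤ M →
      ∀ {Ξ Ω : Type*} [MeasurableSpace Ξ] [MeasurableSpace Ω]
        (P : Kernel (Vec n × Vec d) Ξ) [IsMarkovKernel P]
        (Gδ : Vec n → Vec d → Ξ → Vec n) (Gθ : Vec n → Vec d → Ξ → Vec d),
        StochasticGradients f Δ P Gδ Gθ (σ ^ 2 / M) →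
      ∀ (Pr : Measure Ω) [IsProbabilityMeasure Pr] (ξ : ℕ → ℕ → Ω → Ξ),
        IsAttackSampling Pr Δ P Gδ Gθ η₁ η₂ N K δ₀ θ₀ ξ →
      ∃ t < N,
        let x : Ω → Vec n × Vec d := fun ω =>
          attackIter Δ Gδ Gθ η₁ η₂ K δ₀ θ₀ (fun s j => ξ s j ω) t K
        Integrable (fun ω => fospGap f Δ (x ω).1 (x ω).2) Pr ∧
        ∫ ω, fospGap f Δ (x ω).1 (x ω).2 ∂Pr ≤ ε ∧
        0 < Pr {ω | IsFOSP f Δ ε (x ω).1 (x ω).2} := by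
  obtain ⟨c, hc, hgap⟩ := exists_fospGap_le hconv hcomp hPL hLip hμ hL₁₁ hL₂₂ hL
  obtain ⟨D, hD⟩ : ∃ D, ∀ x ∈ Δ, ∀ y ∈ Δ, ‖x - y‖ ≤ D := by
    obtain ⟨D, hD⟩ := Metric.isBounded_iff.1 hcomp.isBounded
    exact ⟨D, fun x hx y hy => by simpa [dist_eq_norm] using hD hx hy⟩
  obtain ⟨B, hB⟩ := exists_abs_maxVal_le hcomp hPL hLip hμ hL₂₂ hD hδ₀
  have hB0 : 0 ≤ B := (abs_nonneg _).trans (hB δ₀ hδ₀)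
  have hm : 0 < min μ L₂₂ := lt_min hμ hL₂₂
  set m := min μ L₂₂ with hm_def
  set s := m / L₂₂
  have hs : 0 < s := by positivity
  have hs1 : s ≤ 1 := (div_le_one hL₂₂).2 (min_le_right _ _)
  set κ := L₂₂ / μ
  have hκ : 0 < κ := by positivity
  have hA0 := hPL.subopt_nonneg hδ₀ θ₀
  set A := subopt f δ₀ θ₀ + 2 * (κ * (σ ^ 2 / m) + L₁₂ ^ 2 / μ * D ^ 2)
  have hA : 0 ≤ A := by positivity
  set W := A / s + σ ^ 2 / (2 * m) + σ ^ 2 + 2 * B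
  have hW : 0 ≤ W := by positivity
  set C := 1 + 2 / s + 4 * κ / s + 2 * c * W
  have hC1 : 1 ≤ C := by
    have : 0 ≤ 2 / s + 4 * κ / s + 2 * c * W := by positivity
    simp only [C]; linarith
  have hC0 : 0 < C := by linarith
  have hsC : s * C = s + 2 + 4 * κ + s * (2 * c * W) := by simp only [C]; field_simp
  have hscW : 0 ≤ s * (2 * c * W) := by positivity
  have hCW : 2 * c * W ≤ C := by
    have : 0 ≤ 1 + 2 / s + 4 * κ / s := by positivity
    simp only [C]; linarith
  refine ⟨C, hC0, fun ε hε hε1 N K M hN hK hM Ξ Ω _ _ P _ Gδ Gθ hG Pr _ ξ hξ => ?_⟩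
  have hε2 : ε ^ 2 ≤ 1 := pow_le_one₀ hε.le hε1.le
  have hN0 : (0 : ℝ) < N := lt_of_lt_of_le (by positivity) hN
  have hM0 : (0 : ℝ) < M := lt_of_lt_of_le (by positivity) hM
  have hq := one_sub_pow_le hs1 (by linarith) hε hε1 hs.le hK
  have hv0 : 0 ≤ σ ^ 2 / M := by positivity
  have hv : σ ^ 2 / M ≤ σ ^ 2 * (ε ^ 2 / C) := by
    rw [div_eq_mul_inv]
    gcongr
    rw [inv_le_comm₀ hM0 (by positivity), inv_div, div_eq_mul_inv]
    refine le_trans ?_ hM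
    rw [inv_pow]
    gcongr 2
    exact pow_le_pow_of_le_one hε.le hε1.le (by norm_num)
  have hεC : ε ^ 2 / C ≤ 1 := (div_le_one hC0).2 (hε2.trans hC1)
  have hvσ : σ ^ 2 / M ≤ σ ^ 2 := hv.trans (mul_le_of_le_one_right (sq_nonneg σ) hεC)
  have hK1 : 4 * κ * (1 - s) ^ K ≤ 1 := by
    have h1 : (1 - s) ^ K ≤ 1 / (s * C) := hq.trans (by gcongr)
    calc 4 * κ * (1 - s) ^ K ≤ 4 * κ * (1 / (s * C)) := by gcongr
      _ ≤ 1 := by rw [mul_one_div, div_le_one (by positivity)]; linarith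
  set x : ℕ → ℕ → Ω → Vec n × Vec d := fun t k ω =>
    attackIter Δ Gδ Gθ η₁ η₂ K δ₀ θ₀ (fun s j => ξ s j ω) t k with hx
  have hxΔ : ∀ t k ω, (x t k ω).1 ∈ Δ := fun t k ω => attackIter_fst_mem hcomp hδ₀ t k
  obtain ⟨a, ha0, hac, hgap⟩ := hgap ε hε hε1
  set Φ : ℕ → Ω → ℝ := fun t ω => maxVal f (x t 0 ω).1
  have hΦi : ∀ t ≤ N, Integrable (Φ t) Pr := fun t ht =>
    integrable_maxVal_outerIter hconv hcomp hδ₀ hPL hLip hG hξ hB ht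
  set U : ℕ → Ω → ℝ := fun t ω => ε / 2 + a * (Φ t ω - Φ (t + 1) ω)
    + c / ε * (subopt f (x t K ω).1 (x t K ω).2 + sqNoise f Gδ Gθ (x t K ω, ξ t K ω))
  have hpt : ∀ t ω, fospGap f Δ (x t K ω).1 (x t K ω).2 ≤ U t ω := by
    intro t ω
    have h1 := hgap _ (hxΔ t K ω) (x t K ω).2 (Gδ (x t K ω).1 (x t K ω).2 (ξ t K ω))
    rw [← hη₂] at h1
    refine h1.trans (add_le_add_right (mul_le_mul_of_nonneg_left ?_ (by positivity)) _)
    exact add_le_add_right (le_add_of_nonneg_right (sq_nonneg _)) _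
  have hexp : ∀ t < N, Integrable (U t) Pr ∧ ∫ ω, U t ω ∂Pr
      ≤ ε / 2 + c / ε * (ε ^ 2 / C * (A / s + σ ^ 2 / (2 * m) + σ ^ 2))
        + a * (∫ ω, Φ t ω ∂Pr - ∫ ω, Φ (t + 1) ω ∂Pr) := by
    intro t ht
    obtain ⟨h0, h0A⟩ := integrable_subopt_outer hconv hcomp hδ₀ hPL hLip hμ hL₂₂ hη₁ hv0 hG hξ hD
      (A := A) (le_add_of_nonneg_right (by positivity)) hK1
      (le_add_of_nonneg_of_le hA0 (by gcongr)) hx ht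
    obtain ⟨h1, h1A⟩ := integrable_subopt_inner hconv hcomp hδ₀ hPL hLip hμ hL₂₂ hη₁ hv0 hG hξ ht
      (x := x t) rfl h0 le_rfl
    obtain ⟨h2, h2A⟩ := integrable_sqNoise_and_integral_le hcomp hδ₀ hLip hv0 hG hξ ht le_rfl
    have hi1 := ((hΦi t ht.le).sub (hΦi (t + 1) ht)).const_mul a
    have hi2 := (h1.add h2).const_mul (c / ε)
    have hi3 := (integrable_const (μ := Pr) (ε / 2)).add hi1
    refine ⟨hi3.add hi2, ?_⟩
    have e1 : ∫ ω, U t ω ∂Pr = ε / 2 + a * (∫ ω, Φ t ω ∂Pr - ∫ ω, Φ (t + 1) ω ∂Pr)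
        + c / ε * (∫ ω, subopt f (x t K ω).1 (x t K ω).2 ∂Pr
          + ∫ ω, sqNoise f Gδ Gθ (x t K ω, ξ t K ω) ∂Pr) := by
      refine (integral_add hi3 hi2).trans ?_
      congr 1
      · refine (integral_add (integrable_const _) hi1).trans ?_
        rw [integral_const_mul]
        simp only [integral_const, probReal_univ, smul_eq_mul, one_mul, Pi.sub_apply]
        rw [integral_sub (hΦi t ht.le) (hΦi (t + 1) ht)]
      · rw [integral_const_mul]
        congr 1
        exact integral_add h1 h2
    have h3 : (1 - s) ^ K * ∫ ω, subopt f (x t 0 ω).1 (x t 0 ω).2 ∂Pr ≤ ε ^ 2 / (s * C) * A := by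
      gcongr
      exact integral_nonneg fun ω => hPL.subopt_nonneg (hxΔ _ _ ω) _
    have h4 : σ ^ 2 / M / (2 * m) ≤ σ ^ 2 * (ε ^ 2 / C) / (2 * m) := by gcongr
    have h5 : ∫ ω, subopt f (x t K ω).1 (x t K ω).2 ∂Pr
        + ∫ ω, sqNoise f Gδ Gθ (x t K ω, ξ t K ω) ∂Pr
        ≤ ε ^ 2 / C * (A / s + σ ^ 2 / (2 * m) + σ ^ 2) := calc
      _ ≤ ε ^ 2 / (s * C) * A + σ ^ 2 * (ε ^ 2 / C) / (2 * m) + σ ^ 2 * (ε ^ 2 / C) :=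
        add_le_add (h1A.trans (add_le_add h3 h4)) (h2A.trans hv)
      _ = _ := by field_simp
    have h6 := mul_le_mul_of_nonneg_left h5 (by positivity : 0 ≤ c / ε)
    linarith
  have hgi : ∀ t < N, Integrable (fun ω => fospGap f Δ (x t K ω).1 (x t K ω).2) Pr := fun t ht =>
    integrable_fospGap hconv hcomp ⟨δ₀, hδ₀⟩ hLip (hξ.hasCondDistrib ht le_rfl).aemeasurable_fst
      (hxΔ t K) (hexp t ht).1 (hpt t)
  have hΦB : ∀ t, |∫ ω, Φ t ω ∂Pr| ≤ B := fun t => by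
    have := norm_integral_le_of_norm_le_const (μ := Pr) (f := Φ t) (C := B)
      (Filter.Eventually.of_forall fun ω => hB _ (hxΔ t 0 ω))
    simpa using this
  have hfin : N * (ε / 2 + c / ε * (ε ^ 2 / C * (A / s + σ ^ 2 / (2 * m) + σ ^ 2))) + a * (2 * B)
      ≤ N * ε := by
    have h1 : 1 ≤ N * (ε ^ 2 / C) := by
      rw [← mul_div_assoc, one_le_div hC0]
      calc C = C * ε⁻¹ ^ 2 * ε ^ 2 := by field_simp
        _ ≤ N * ε ^ 2 := by gcongr
    have h2 : a * (2 * B) ≤ N * (c / ε * (ε ^ 2 / C * (2 * B))) := calc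
      a * (2 * B) ≤ c / ε * (2 * B) * 1 := by rw [mul_one]; gcongr
      _ ≤ c / ε * (2 * B) * (N * (ε ^ 2 / C)) := by gcongr
      _ = _ := by ring
    have h3 : c / ε * (ε ^ 2 / C * W) ≤ ε / 2 := by
      have : c / ε * (ε ^ 2 / C * W) = ε / 2 * (2 * c * W / C) := by field_simp
      rw [this]
      exact mul_le_of_le_one_right (by positivity) ((div_le_one hC0).2 hCW)
    have h4 := mul_le_mul_of_nonneg_left h3 hN0.le
    have h5 : N * (c / ε * (ε ^ 2 / C * W))
        = N * (c / ε * (ε ^ 2 / C * (A / s + σ ^ 2 / (2 * m) + σ ^ 2)))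
          + N * (c / ε * (ε ^ 2 / C * (2 * B))) := by simp only [W]; ring
    linarith
  obtain ⟨t, ht, hle⟩ := exists_lt_le_of_le_telescope (Nat.cast_pos.1 hN0) ha0
    (fun t ht => (integral_mono (hgi t ht) (hexp t ht).1 (hpt t)).trans (hexp t ht).2) hΦB hfin
  refine ⟨t, ht, hgi t ht, hle, (measure_le_integral_pos (hgi t ht)).trans_le ?_⟩
  exact measure_mono fun ω hω => (isFOSP_iff_fospGap_le f Δ ε (hxΔ t K ω) _).2 (le_trans hω hle)
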